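/- Let $\Lambda$ be the ring of symmetric functions over $\mathbb{Q}$ in the variables $x_1,x_2,\dots$, with monomial basis $m_\lambda$, elementary symmetric functions $e_r$, $e_\mu=\prod_i e_{\mu_i}$, and Schur functions $s_\lambda=\sum_{T}\mathbf{x}^T$ (sum over semistandard Young tableaux $T$ of shape $\lambda$). For an integer $k\ge 1$ let $\rho_k:\Lambda\to\Lambda$ be the $\mathbb{Q}$-linear map with \[ \rho_k(m_\mu)=\begin{cases} m_{\mu/k} & \text{if every part of } \mu \text{ is divisible by } k,\\ 0 & \text{otherwise,}\end{cases} \] where $\mu/k=(\mu_1/k,\mu_2/k,\dots)$. For a partition $\lambda$ with $\ell$ parts put $\rho=(\ell-1,\ell-2,\dots,1,0)$ and let $a_\lambda$ be the skew shape \[ a_\lambda=\bigl(k\lambda+(k-1)\rho\bigr)\big/(k-1)\rho . \] Theorem. Let $k\ge 1$, $n\ge 0$. For every partition $\mu\vdash kn$, \[ \rho_k(e_\mu)=\sum_{\lambda\vdash n}K_{a_\lambda',\,\mu}\; s_\lambda , \] where $a_\lambda'$ is the conjugate (transpose) of the skew shape $a_\lambda$ and $K_{a_\lambda',\mu}$ is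 the number of semistandard Young tableaux of skew shape $a_\lambda'$ and type $\mu$ (i.e. with exactly $\mu_i$ entries equal to $i$ for every $i$). In particular, for $\mu=1^{kn}$, \[ \rho_k(e_{1^{kn}})=\sum_{\lambda\vdash n} f^{a_\lambda}\, s_\lambda , \] where $f^{a_\lambda}$ is the number of standard Young tableaux of skew shape $a_\lambda$. -/

import Mathlib

namespace SymFun

noncomputable section

/-! Variables are indexed by `ℕ`, so that `x_0, x_1, x_2, …` play the role of
`x_1, x_2, x_3, …`.  In the same way tableau entries start at `0` (as in
`SemistandardYoungTableau`) and rows, columns and parts are numbered from `0`. -/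

/-! ### Partitions -/

/-- The parts of a partition, as a weakly decreasing list. -/
def partsList {n : ℕ} (p : n.Partition) : List ℕ := p.parts.sort (· ≥ ·)

/-- The `i`-th largest part of a partition (counting from `0`), and `0` when `i` is at least the
number of parts. -/
def part {n : ℕ} (p : n.Partition) (i : ℕ) : ℕ := (partsList p).getD i 0

/-- The number of parts `ℓ(p)`. -/
def len {n : ℕ} (p : n.Partition) : ℕ := p.parts.card

/-- The exponent vector `x_0 ^ p_0 * x_1 ^ p_1 * ⋯` of a partition. -/
def expo {n : ℕ} (p : n.Partition) : ℕ →₀ ℕ := (partsList p).toFinsupp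

/-- The partition `p / k` with parts `p_i / k`; used only when `k` divides all parts of `p`. -/
def divPartition (k : ℕ) {n : ℕ} (p : n.Partition) : (p.parts.map (· / k)).sum.Partition :=
  Nat.Partition.ofMultiset (p.parts.map (· / k))

/-- The partition `1 ^ n = (1, …, 1)` of `n`. -/
def onesPartition (n : ℕ) : n.Partition where
  parts := Multiset.replicate n 1
  parts_pos h := by rw [Multiset.eq_of_mem_replicate h]; exact one_pos
  parts_sum := by simp

theorem part_antitone {n : ℕ} (p : n.Partition) : Antitone (part p) := by
  have hs : (partsList p).Pairwise (· ≥ ·) := Multiset.pairwise_sort _ _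
  intro i j hij
  unfold part
  rcases lt_or_ge j (partsList p).length with hj | hj
  · rw [List.getD_eq_getElem _ _ hj, List.getD_eq_getElem _ _ (lt_of_le_of_lt hij hj)]
    rcases hij.eq_or_lt with rfl | h
    · exact le_rfl
    · exact List.pairwise_iff_getElem.1 hs i j _ hj h
  · rw [List.getD_eq_default _ _ hj]
    exact Nat.zero_le _

/-! ### The ring of symmetric functions -/

/-- The ring `Λ` of symmetric functions over `ℚ`: formal power series of bounded degree in
countably many variables that are invariant under all permutations of the variables. -/
def Symm : Subalgebra ℚ (MvPowerSeries ℕ ℚ) where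
  carrier := {f | (∃ d : ℕ, ∀ a : ℕ →₀ ℕ, d < a.degree → MvPowerSeries.coeff a f = 0) ∧
    ∀ σ : Equiv.Perm ℕ, MvPowerSeries.renameEquiv ℚ σ f = f}
  mul_mem' := by
    rintro f g ⟨⟨d, hd⟩, hf⟩ ⟨⟨e, he⟩, hg⟩
    refine ⟨⟨d + e, fun a ha => ?_⟩, fun σ => by rw [map_mul, hf, hg]⟩
    classical
    rw [MvPowerSeries.coeff_mul]
    refine Finset.sum_eq_zero fun x hx => ?_
    have hdeg : x.1.degree + x.2.degree = a.degree := by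
      rw [← map_add, Finset.HasAntidiagonal.mem_antidiagonal.1 hx]
    rcases lt_or_ge d x.1.degree with h | h
    · rw [hd _ h, zero_mul]
    · rw [he _ (by omega), mul_zero]
  add_mem' := by
    rintro f g ⟨⟨d, hd⟩, hf⟩ ⟨⟨e, he⟩, hg⟩
    refine ⟨⟨d + e, fun a ha => ?_⟩, fun σ => by rw [map_add, hf, hg]⟩
    rw [map_add, hd _ (by omega), he _ (by omega), add_zero]
  algebraMap_mem' r := by
    refine ⟨⟨0, fun a ha => ?_⟩, fun σ => AlgEquiv.commutes _ _⟩
    classical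
    rw [MvPowerSeries.algebraMap_apply, MvPowerSeries.coeff_C, if_neg]
    rintro rfl
    simp at ha

theorem coeff_renameEquiv (σ : Equiv.Perm ℕ) (f : MvPowerSeries ℕ ℚ) (a : ℕ →₀ ℕ) :
    MvPowerSeries.coeff (a.embDomain σ.toEmbedding) (MvPowerSeries.renameEquiv ℚ σ f) =
      MvPowerSeries.coeff a f :=
  MvPowerSeries.coeff_embDomain_rename σ.toEmbedding f a

theorem renameEquiv_eq_self {f : MvPowerSeries ℕ ℚ} (σ : Equiv.Perm ℕ)
    (h : ∀ a : ℕ →₀ ℕ, MvPowerSeries.coeff (a.embDomain σ.toEmbedding) f =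
      MvPowerSeries.coeff a f) : MvPowerSeries.renameEquiv ℚ σ f = f := by
  ext b
  have hb : b = (b.embDomain σ.symm.toEmbedding).embDomain σ.toEmbedding := by
    ext i
    obtain ⟨j, rfl⟩ := σ.surjective i
    have h1 := Finsupp.embDomain_apply_self σ.toEmbedding (b.embDomain σ.symm.toEmbedding) j
    have h2 := Finsupp.embDomain_apply_self σ.symm.toEmbedding b (σ j)
    simp only [Equiv.coe_toEmbedding, Equiv.symm_apply_apply] at h1 h2
    rw [h1, h2]
  rw [hb, coeff_renameEquiv, h]

/-- The multiset of nonzero exponents of an exponent vector. -/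
def expoType (a : ℕ →₀ ℕ) : Multiset ℕ := a.support.val.map a

theorem expoType_embDomain (σ : Equiv.Perm ℕ) (a : ℕ →₀ ℕ) :
    expoType (a.embDomain σ.toEmbedding) = expoType a := by
  unfold expoType
  rw [Finsupp.support_embDomain, Finset.map_val, Multiset.map_map]
  refine Multiset.map_congr rfl fun i _ => ?_
  exact Finsupp.embDomain_apply_self _ _ _

theorem expoType_sum (a : ℕ →₀ ℕ) : (expoType a).sum = a.degree := rfl

/-! ### Monomial and elementary symmetric functions -/

/-- The monomial symmetric function `m_p`: the sum of all monomials whose exponent vector is a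
rearrangement of `p`. -/
def monomialSymm {n : ℕ} (p : n.Partition) : Symm :=
  ⟨fun a => if expoType a = p.parts then 1 else 0, by
    have hc : ∀ a : ℕ →₀ ℕ, MvPowerSeries.coeff a
        (fun a => if expoType a = p.parts then 1 else 0 : MvPowerSeries ℕ ℚ) =
        if expoType a = p.parts then 1 else 0 := fun _ => rfl
    refine ⟨⟨n, fun a ha => ?_⟩, fun σ => renameEquiv_eq_self σ fun a => ?_⟩
    · rw [hc, if_neg]
      intro h
      rw [← expoType_sum, h, p.parts_sum] at ha
      exact lt_irrefl _ ha
    · rw [hc, hc, expoType_embDomain]⟩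

open Classical in
/-- The elementary symmetric function `e_r`: the sum of all squarefree monomials of degree `r`. -/
def elem (r : ℕ) : Symm :=
  ⟨fun a => if a.degree = r ∧ ∀ i, a i ≤ 1 then 1 else 0, by
    have hc : ∀ a : ℕ →₀ ℕ, MvPowerSeries.coeff a
        (fun a => if a.degree = r ∧ ∀ i, a i ≤ 1 then 1 else 0 : MvPowerSeries ℕ ℚ) =
        if a.degree = r ∧ ∀ i, a i ≤ 1 then 1 else 0 := fun _ => rfl
    refine ⟨⟨r, fun a ha => ?_⟩, fun σ => renameEquiv_eq_self σ fun a => ?_⟩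
    · rw [hc, if_neg]
      rintro ⟨h, -⟩
      omega
    · have h1 : (a.embDomain σ.toEmbedding).degree = a.degree := by
        rw [← expoType_sum, expoType_embDomain, expoType_sum]
      have h2 : (∀ i, a.embDomain σ.toEmbedding i ≤ 1) ↔ ∀ i, a i ≤ 1 := by
        rw [← σ.forall_congr_right (q := fun i => a.embDomain σ.toEmbedding i ≤ 1)]
        refine forall_congr' fun i => ?_
        rw [← Equiv.coe_toEmbedding σ, Finsupp.embDomain_apply_self]
      rw [hc, hc, h1, h2]⟩

/-- `e_p = e_{p_0} * e_{p_1} * ⋯`. -/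
def elemPartition {n : ℕ} (p : n.Partition) : Symm := (p.parts.map elem).prod

/-! ### The monomial basis -/

/-- Partitions of all natural numbers. -/
abbrev AllPartitions : Type := Σ n : ℕ, n.Partition

theorem allPartitions_ext {p q : AllPartitions} (h : p.2.parts = q.2.parts) : p = q := by
  obtain ⟨n, p⟩ := p
  obtain ⟨m, q⟩ := q
  have hnm : n = m := by rw [← p.parts_sum, ← q.parts_sum]; exact congrArg _ h
  subst hnm
  have hpq : p = q := Nat.Partition.ext h
  rw [hpq]

theorem expoType_expo {n : ℕ} (p : n.Partition) : expoType (expo p) = p.parts := by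
  have hmem : ∀ x ∈ partsList p, x ≠ 0 := fun x hx =>
    (p.parts_pos ((Multiset.mem_sort (· ≥ ·)).1 hx)).ne'
  have hsupp : (expo p).support = Finset.range (partsList p).length := by
    unfold expo
    rw [List.toFinsupp_support, Finset.filter_eq_self]
    intro i hi
    rw [List.getD_eq_getElem _ _ (Finset.mem_range.1 hi)]
    exact hmem _ (List.getElem_mem _)
  have hl : (List.range (partsList p).length).map (expo p) = partsList p := by
    refine List.ext_getElem (by simp) fun i h1 h2 => ?_
    rw [List.getElem_map, List.getElem_range]
    exact List.toFinsupp_apply_lt _ _ h2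
  unfold expoType
  rw [hsupp]
  change ((List.range (partsList p).length).map (expo p) : Multiset ℕ) = _
  rw [hl]
  exact Multiset.sort_eq _ _

/-- The partition formed by the nonzero exponents of an exponent vector. -/
def typePartition (a : ℕ →₀ ℕ) : AllPartitions :=
  ⟨a.degree, expoType a, by
    intro i hi
    obtain ⟨j, hj, rfl⟩ := Multiset.mem_map.1 hi
    exact Nat.pos_of_ne_zero (Finsupp.mem_support_iff.1 hj), expoType_sum a⟩

theorem exists_perm_of_expoType_eq {a b : ℕ →₀ ℕ} (h : expoType a = expoType b) :
    ∃ σ : Equiv.Perm ℕ, a.embDomain σ.toEmbedding = b := by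
  classical
  have hcard : ∀ v : ℕ, Fintype.card {i : a.support // a i = v} =
      Fintype.card {i : b.support // b i = v} := by
    have key : ∀ (c : ℕ →₀ ℕ) (v : ℕ), Fintype.card {i : c.support // c i = v} =
        (expoType c).count v := by
      intro c v
      rw [expoType, Multiset.count_map, Fintype.card_subtype, ← Finset.card_map
        (Function.Embedding.subtype _)]
      refine congrArg Multiset.card (?_ : (_ : Finset ℕ).val = (c.support.filter (v = c ·)).val)
      congr 1
      ext i
      simp only [Finset.mem_map, Finset.mem_filter, Finset.mem_univ, true_and,
        Function.Embedding.subtype_apply, Subtype.exists, exists_and_right, exists_eq_right]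
      constructor
      · rintro ⟨h1, h2⟩
        exact ⟨h1, h2.symm⟩
      · rintro ⟨h1, h2⟩
        exact ⟨h1, h2.symm⟩
    intro v
    rw [key, key, h]
  let e : a.support ≃ b.support :=
    Equiv.ofFiberEquiv (f := fun i : a.support => a i) (g := fun i : b.support => b i)
      fun v => Fintype.equivOfCardEq (hcard v)
  have he : ∀ i, b (e i) = a i := fun i =>
    Equiv.ofFiberEquiv_map (f := fun i : a.support => a i) (g := fun i : b.support => b i) _ i
  obtain ⟨σ, hσ⟩ := Equiv.Perm.exists_extending_pair (fun i : a.support => (i : ℕ))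
    (fun i : a.support => (e i : ℕ)) Subtype.val_injective
    (Subtype.val_injective.comp e.injective)
  refine ⟨σ, ?_⟩
  ext j
  obtain ⟨i, rfl⟩ := σ.surjective j
  refine (Finsupp.embDomain_apply_self σ.toEmbedding a i).trans ?_
  by_cases hi : i ∈ a.support
  · rw [hσ ⟨i, hi⟩, he]
  · rw [Finsupp.notMem_support_iff.1 hi]
    by_contra hne
    have hj : σ i ∈ b.support := Finsupp.mem_support_iff.2 (Ne.symm hne)
    have h1 := hσ (e.symm ⟨σ i, hj⟩)
    simp only [Equiv.apply_symm_apply] at h1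
    exact hi (σ.injective h1 ▸ (e.symm ⟨σ i, hj⟩).2)

theorem coeff_eq_of_expoType_eq (f : Symm) {a b : ℕ →₀ ℕ} (h : expoType a = expoType b) :
    MvPowerSeries.coeff a (f : MvPowerSeries ℕ ℚ) = MvPowerSeries.coeff b f.1 := by
  obtain ⟨σ, rfl⟩ := exists_perm_of_expoType_eq h
  have h1 := coeff_renameEquiv σ f.1 a
  rw [f.2.2 σ] at h1
  exact h1.symm

theorem coeff_monomialSymm {n : ℕ} (p : n.Partition) (a : ℕ →₀ ℕ) :
    MvPowerSeries.coeff a (monomialSymm p : MvPowerSeries ℕ ℚ) =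
      if expoType a = p.parts then 1 else 0 := rfl

theorem coeff_linearCombination (c : AllPartitions →₀ ℚ) (a : ℕ →₀ ℕ) :
    MvPowerSeries.coeff a
      ((Finsupp.linearCombination ℚ (fun p : AllPartitions => monomialSymm p.2) c : Symm) :
        MvPowerSeries ℕ ℚ) = c (typePartition a) := by
  let L : Symm →ₗ[ℚ] ℚ := (MvPowerSeries.coeff a).comp Symm.toSubmodule.subtype
  have hL : ∀ f : Symm, L f = MvPowerSeries.coeff a f.1 := fun _ => rfl
  rw [← hL, Finsupp.linearCombination_apply, map_finsuppSum, Finsupp.sum,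
    Finset.sum_eq_single (typePartition a)]
  · have h1 : expoType a = (typePartition a).2.parts := rfl
    rw [map_smul, hL, coeff_monomialSymm, if_pos h1, smul_eq_mul, mul_one]
  · intro p _ hp
    rw [map_smul, hL, coeff_monomialSymm, if_neg, smul_zero]
    exact fun h => hp (allPartitions_ext h.symm)
  · intro hp
    rw [Finsupp.notMem_support_iff.1 hp, zero_smul, map_zero]

theorem monomialSymm_linearIndependent :
    LinearIndependent ℚ (fun p : AllPartitions => monomialSymm p.2) := by
  rw [linearIndependent_iff]
  intro c hc
  ext p
  have h := coeff_linearCombination c (expo p.2)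
  rw [hc] at h
  have hp : typePartition (expo p.2) = p := allPartitions_ext (expoType_expo p.2)
  rw [hp] at h
  exact h.symm

theorem monomialSymm_span :
    ⊤ ≤ Submodule.span ℚ (Set.range (fun p : AllPartitions => monomialSymm p.2)) := by
  classical
  intro f _
  obtain ⟨d, hd⟩ := f.2.1
  rw [← Finsupp.range_linearCombination]
  refine ⟨Finsupp.onFinset ((Finset.range (d + 1)).sigma fun n => (Finset.univ : Finset n.Partition))
    (fun p => MvPowerSeries.coeff (expo p.2) f.1) ?_, ?_⟩
  · intro p hp
    rw [Finset.mem_sigma]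
    refine ⟨?_, Finset.mem_univ _⟩
    by_contra h
    refine hp (hd _ ?_)
    rw [← expoType_sum, expoType_expo, p.2.parts_sum]
    simpa using h
  · refine Subtype.ext (MvPowerSeries.ext fun a => ?_)
    rw [coeff_linearCombination, Finsupp.onFinset_apply]
    exact coeff_eq_of_expoType_eq f (expoType_expo _)

/-- The basis of `Λ` consisting of the monomial symmetric functions. -/
def monomialBasis : Module.Basis AllPartitions ℚ Symm :=
  Module.Basis.mk monomialSymm_linearIndependent monomialSymm_span

/-- The partition division map `ρ_k`: the linear map on `Λ` that sends `m_p` to `m_{p / k}` if all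
parts of `p` are divisible by `k`, and to `0` otherwise. -/
def rowDiv (k : ℕ) : Symm →ₗ[ℚ] Symm :=
  monomialBasis.constr ℚ fun p =>
    open Classical in
    if ∀ i ∈ p.2.parts, k ∣ i then monomialSymm (divPartition k p.2) else 0

theorem rowDiv_monomialSymm (k : ℕ) {n : ℕ} (p : n.Partition) :
    rowDiv k (monomialSymm p) =
      open Classical in
      if ∀ i ∈ p.parts, k ∣ i then monomialSymm (divPartition k p) else 0 := by
  have h : monomialBasis ⟨n, p⟩ = monomialSymm p := by
    rw [monomialBasis, Module.Basis.mk_apply]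
  rw [← h, rowDiv, Module.Basis.constr_basis]

/-! ### Young diagrams, tableaux and Schur functions -/

/-- The Young diagram with row lengths `r 0 ≥ r 1 ≥ ⋯ ≥ r (l - 1)`. -/
def rowDiagram (l : ℕ) (r : ℕ → ℕ) (hr : Antitone r) : YoungDiagram :=
  YoungDiagram.ofRowLens ((List.range l).map r) (by
    refine List.Pairwise.sortedGE (List.pairwise_map.2 ?_)
    exact List.pairwise_lt_range.imp fun h => hr h.le)

/-- The Young diagram of a partition. -/
def diagram {n : ℕ} (p : n.Partition) : YoungDiagram := rowDiagram (len p) (part p) (part_antitone p)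

/-- The content of a semistandard tableau: the number of its entries equal to `i`, for each `i`. -/
def content {D : YoungDiagram} (T : SemistandardYoungTableau D) : ℕ →₀ ℕ :=
  ∑ c ∈ D.cells, Finsupp.single (T c.1 c.2) 1

/-- The Schur function `s_p = ∑_T x ^ T`, the sum being over all semistandard tableaux `T` of
shape `p`, as a formal power series. -/
def schur {n : ℕ} (p : n.Partition) : MvPowerSeries ℕ ℚ :=
  fun a => (Nat.card {T : SemistandardYoungTableau (diagram p) // content T = a} : ℚ)

/-- A skew shape `outer / inner`. -/
structure SkewShape where
  outer : YoungDiagram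
  inner : YoungDiagram
  inner_le : inner ≤ outer

/-- The cells `(row, column)` of a skew shape. -/
def SkewShape.cells (A : SkewShape) : Finset (ℕ × ℕ) := A.outer.cells \ A.inner.cells

/-- The conjugate `(α / β)' = α' / β'`. -/
def SkewShape.transpose (A : SkewShape) : SkewShape where
  outer := A.outer.transpose
  inner := A.inner.transpose
  inner_le := YoungDiagram.transpose_mono A.inner_le

/-- Semistandard tableaux of skew shape: rows weakly increase and columns strictly increase.
As for `SemistandardYoungTableau`, the entry outside the shape is `0` by convention. -/
structure SkewSSYT (A : SkewShape) where
  entry : ℕ → ℕ → ℕ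
  row_weak : ∀ {i j1 j2 : ℕ}, j1 < j2 → (i, j1) ∈ A.cells → (i, j2) ∈ A.cells →
    entry i j1 ≤ entry i j2
  col_strict : ∀ {i1 i2 j : ℕ}, i1 < i2 → (i1, j) ∈ A.cells → (i2, j) ∈ A.cells →
    entry i1 j < entry i2 j
  zeros : ∀ {i j : ℕ}, (i, j) ∉ A.cells → entry i j = 0

/-- The content (type) of a skew semistandard tableau. -/
def SkewSSYT.content {A : SkewShape} (T : SkewSSYT A) : ℕ →₀ ℕ :=
  ∑ c ∈ A.cells, Finsupp.single (T.entry c.1 c.2) 1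

/-- `K_{A,p}`: the number of semistandard tableaux of skew shape `A` and type `p`. -/
def kostka (A : SkewShape) {n : ℕ} (p : n.Partition) : ℕ :=
  Nat.card {T : SkewSSYT A // T.content = expo p}

/-- Standard tableaux of skew shape: bijective fillings with `0, 1, …, N - 1`, where `N` is the
number of cells, which strictly increase along rows and down columns. -/
structure SkewSYT (A : SkewShape) where
  filling : A.cells ≃ Fin A.cells.card
  row_strict : ∀ {c d : A.cells}, c.1.1 = d.1.1 → c.1.2 < d.1.2 → filling c < filling d
  col_strict : ∀ {c d : A.cells}, c.1.2 = d.1.2 → c.1.1 < d.1.1 → filling c < filling d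

/-- `f^A`: the number of standard tableaux of skew shape `A`. -/
def numSYT (A : SkewShape) : ℕ := Nat.card (SkewSYT A)

/-- The skew shape `a_p = (k p + (k - 1) ρ) / (k - 1) ρ`, where `ρ = (l - 1, l - 2, …, 1, 0)` and
`l` is the number of parts of `p`. -/
def stretchedShape (k : ℕ) {n : ℕ} (p : n.Partition) : SkewShape where
  outer := rowDiagram (len p) (fun i => k * part p i + (k - 1) * (len p - 1 - i))
    fun i j hij => Nat.add_le_add (Nat.mul_le_mul_left _ (part_antitone p hij))
      (Nat.mul_le_mul_left _ (by omega))
  inner := rowDiagram (len p) (fun i => (k - 1) * (len p - 1 - i))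
    fun i j hij => Nat.mul_le_mul_left _ (by omega)
  inner_le := by
    intro c hc
    obtain ⟨h, h'⟩ := YoungDiagram.mem_ofRowLens.1 hc
    refine YoungDiagram.mem_ofRowLens.2 ⟨by simpa using h, ?_⟩
    simp only [List.getElem_map, List.getElem_range] at h' ⊢
    omega

end

end SymFun

namespace SymFun

/-! ### Walks with prescribed end points -/

/-! Write δ = (0, 1, …, N - 1) and a_v = det (x_i ^ v_j), work in N ≥ n variables, and multiply by
an alternant before dividing exponents. On power series ρ_k is the coefficient map `divExpo`: keep
the monomials whose exponents are all divisible by k, and divide these exponents by k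
(`rowDiv_eq_divExpo`). Hence ρ_k(f · a_{kδ}) = ρ_k(f) · a_δ (`divExpo_mul_alternant`), ρ_k(a_{kw}) =
a_w, and ρ_k(a_v) = 0 if k fails to divide some v_j.

By Pieri's rule, multiplying a_v, v strictly increasing, by e_r adds 1 to r of the exponents in all
ways that keep them strictly increasing. Iterating, the coefficient of a_v in e_μ · a_{kδ} is the
number of walks from kδ to v whose steps are such vertical strips of sizes μ_0, μ_1, …
(`prod_esymmFin_mul_alternant`). Under ρ_k only v = k(λ + δ) with λ ⊢ n survives, λ being written in
increasing order. Cancelling a_δ and using a_{λ+δ} = s_λ · a_δ shows that the coefficient of s_λ in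
ρ_k(e_μ) is the number of walks from kδ to k(λ + δ) (`divExpo_restrictVars_elemPartition`).

Subtracting δ turns strict increase into weak increase and the end points into (k - 1)δ and kλ + (k
- 1)δ, which are the inner and outer shapes of a_λ up to a common shift of the rows. So the walks
are chains of shapes filling a_λ by vertical strips, that is, semistandard tableaux of the conjugate
shape of type μ (`kostka_eq_walkCount`).

It remains to match s_λ, defined by tableaux, with the quotient of alternants. Both obey the same
branching over the last variable: for alternants by row operations (`alternant_succ`), for tableaux
by removing the largest entries, and both are counted by Gelfand–Tsetlin patterns
(`coeff_branchSchur`, `card_semistandard`). For μ = 1^{kn} a semistandard tableau is standard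
(`numSYT_eq_kostka`). -/

/-- `g` is a walk from `u` to `v` in `M` steps, the `t`-th step being allowed by `Step t`; the walk
is constant after the `M`-th step. -/
def IsWalk {V : Type*} (Step : ℕ → V → V → Prop) (u : V) (M : ℕ) (v : V) (g : ℕ → V) : Prop :=
  g 0 = u ∧ (∀ t < M, Step t (g t) (g (t + 1))) ∧ ∀ t, M ≤ t → g t = v

/-- The number of walks. -/
noncomputable def walkCount {V : Type*} (Step : ℕ → V → V → Prop) (u : V) (M : ℕ) (v : V) : ℕ :=
  Nat.card {g : ℕ → V // IsWalk Step u M v g}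

section Walk

variable {V : Type*} {Step : ℕ → V → V → Prop} {u : V}

theorem walkCount_zero (Step : ℕ → V → V → Prop) (u v : V) :
    walkCount Step u 0 v = open Classical in if v = u then 1 else 0 := by
  classical
  unfold walkCount
  split_ifs with h
  · subst h
    rw [Nat.card_eq_one_iff_unique]
    refine ⟨⟨fun a b => Subtype.ext (funext fun t => ?_)⟩, ⟨fun _ => v, rfl, by simp, by simp⟩⟩
    rw [a.2.2.2 t (Nat.zero_le _), b.2.2.2 t (Nat.zero_le _)]
  · have : IsEmpty {g : ℕ → V // IsWalk Step u 0 v g} :=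
      ⟨fun g => h (by rw [← g.2.2.2 0 le_rfl, g.2.1])⟩
    exact Nat.card_of_isEmpty

/-- Splitting off the last step of a walk. -/
def walkEquiv (Step : ℕ → V → V → Prop) (u : V) (M : ℕ) (v : V) :
    {g : ℕ → V // IsWalk Step u (M + 1) v g} ≃
      Σ w : {w // Step M w v}, {g : ℕ → V // IsWalk Step u M w g} where
  toFun g := ⟨⟨g.1 M, by
      have h := g.2.2.1 M (Nat.lt_succ_self M)
      rwa [g.2.2.2 (M + 1) le_rfl] at h⟩, fun t => g.1 (min t M), by
        dsimp only; rw [Nat.zero_min]; exact g.2.1, fun t ht => by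
        dsimp only; rw [min_eq_left ht.le, min_eq_left (Nat.succ_le_of_lt ht)]
        exact g.2.2.1 t (by omega), fun t ht => by dsimp only; rw [min_eq_right ht]⟩
  invFun x := ⟨fun t => if t ≤ M then x.2.1 t else v, by
      simpa using x.2.2.1, fun t ht => by
        dsimp only
        rcases Nat.lt_or_ge t M with h | h
        · rw [if_pos h.le, if_pos (Nat.succ_le_of_lt h)]
          exact x.2.2.2.1 t h
        · obtain rfl : t = M := by omega
          rw [if_pos le_rfl, if_neg (by omega), x.2.2.2.2 t le_rfl]
          exact x.1.2, fun t ht => if_neg (by omega)⟩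
  left_inv g := by
    refine Subtype.ext (funext fun t => ?_)
    dsimp only
    split_ifs with h
    · rw [min_eq_left h]
    · rw [g.2.2.2 t (by omega)]
  right_inv x := by
    obtain ⟨⟨w, hw⟩, g, hg⟩ := x
    have h1 : g M = w := hg.2.2 M le_rfl
    subst h1
    refine Sigma.ext (Subtype.ext (by simp)) ?_
    refine (Subtype.heq_iff_coe_eq fun f => ?_).2 (funext fun t => ?_)
    · simp
    · dsimp only
      rw [if_pos (min_le_right t M)]
      rcases le_total t M with h | h
      · rw [min_eq_left h]
      · rw [min_eq_right h, hg.2.2 t h]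

/-- Needed because `Nat.card` of an infinite type is 0, so that counts of walks add up only if they
are finite. -/
theorem finite_walk (hfin : ∀ t v, {w | Step t w v}.Finite) (M : ℕ) (v : V) :
    Finite {g : ℕ → V // IsWalk Step u M v g} := by
  induction M generalizing v with
  | zero =>
    refine @Finite.of_subsingleton _ ⟨fun a b => Subtype.ext (funext fun t => ?_)⟩
    rw [a.2.2.2 t (Nat.zero_le _), b.2.2.2 t (Nat.zero_le _)]
  | succ M ih =>
    have : Finite {w // Step M w v} := hfin M v
    have := fun w => ih w
    exact Finite.of_equiv _ (walkEquiv Step u M v).symm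

theorem walkCount_succ (hfin : ∀ t v, {w | Step t w v}.Finite) (M : ℕ) (v : V) {s : Finset V}
    (hs : ∀ w, w ∈ s ↔ Step M w v) :
    walkCount Step u (M + 1) v = ∑ w ∈ s, walkCount Step u M w := by
  have h1 : Finite {w // Step M w v} := hfin M v
  have h2 := fun w => finite_walk (u := u) hfin M w
  have := Fintype.ofFinite {w // Step M w v}
  rw [walkCount, Nat.card_congr (walkEquiv Step u M v), Nat.card_sigma]
  exact (Finset.sum_subtype s hs (fun w => walkCount Step u M w)).symm

end Walk

/-! ### Alternants -/

section Alternant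

variable {R : Type*} [CommRing R]

/-- The alternant `det (x_i ^ v_j)`. -/
noncomputable def alternant (x : ℕ → R) (N : ℕ) (v : Fin N → ℕ) : R :=
  (Matrix.of fun j i : Fin N => x i ^ v j).det

theorem alternant_eq_zero (x : ℕ → R) {N : ℕ} {v : Fin N → ℕ} (h : ¬ Function.Injective v) :
    alternant x N v = 0 := by
  simp only [Function.Injective, not_forall] at h
  obtain ⟨i, j, hij, hne⟩ := h
  exact Matrix.det_zero_of_row_eq hne (by ext; simp [hij])

theorem alternant_eq_sum (x : ℕ → R) (N : ℕ) (v : Fin N → ℕ) :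
    alternant x N v =
      ∑ σ : Equiv.Perm (Fin N), (Equiv.Perm.sign σ : ℤ) • ∏ i : Fin N, x i ^ v (σ i) := by
  rw [alternant, Matrix.det_apply]
  rfl

/-- The elementary symmetric polynomial of degree `r` in `x_0, …, x_{N - 1}`. -/
noncomputable def esymmFin (x : ℕ → R) (N r : ℕ) : R :=
  ∑ S ∈ Finset.powersetCard r (Finset.univ : Finset (Fin N)), ∏ i ∈ S, x i

/-- Pieri's rule for alternants. -/
theorem esymmFin_mul_alternant (x : ℕ → R) (N r : ℕ) (v : Fin N → ℕ) :
    esymmFin x N r * alternant x N v =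
      ∑ S ∈ Finset.powersetCard r (Finset.univ : Finset (Fin N)),
        alternant x N (fun j => v j + if j ∈ S then 1 else 0) := by
  simp only [alternant_eq_sum]
  rw [Finset.sum_comm, Finset.mul_sum]
  refine Finset.sum_congr rfl fun σ _ => ?_
  rw [mul_smul_comm, ← Finset.smul_sum, esymmFin, Finset.sum_mul]
  congr 1
  -- For a fixed σ, multiplying the term of σ by ∏_{i ∈ S} x_i raises the exponents `v (σ i)` with
  -- `i ∈ S`, hence the entries of `v` at σ(S).
  refine Finset.sum_equiv σ.finsetCongr (fun S => ?_) fun S _ => ?_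
  · simp [Finset.mem_powersetCard]
  · rw [← Finset.prod_filter_mul_prod_filter_not Finset.univ (· ∈ S), mul_comm]
    rw [← Finset.prod_filter_mul_prod_filter_not Finset.univ (· ∈ S)
      (fun i : Fin N => x i ^ (v (σ i) + _))]
    have h : ∏ i ∈ S, x i = ∏ i ∈ Finset.univ.filter (· ∈ S), x i := by
      congr 1; ext; simp
    rw [h, mul_right_comm, ← Finset.prod_mul_distrib]
    congr 1
    · refine Finset.prod_congr rfl fun i hi => ?_
      have : i ∈ S := by simpa using hi
      simp [pow_succ, this]
    · refine Finset.prod_congr rfl fun i hi => ?_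
      have : i ∉ S := by simpa using hi
      simp [this]

/-! ### Branching of alternants and the bialternant formula -/

/-- A geometric sum. It extracts the factor x_i - x_N from an entry of the alternant after a row
operation; the summation index q runs through one interlacing interval. -/
theorem pow_sub_eq_geom (x y : R) {a b : ℕ} (j : ℕ) (h : a ≤ b) :
    x ^ (b + (j + 1)) - y ^ (b + 1 - a) * x ^ (a + j) =
      (x - y) * ∑ q ∈ Finset.Icc a b, y ^ (b - q) * x ^ (q + j) := by
  obtain ⟨d, rfl⟩ := Nat.exists_eq_add_of_le h
  clear h
  induction d with
  | zero => simp; ring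
  | succ d ih =>
    rw [← add_assoc a d 1, Finset.sum_Icc_succ_top (by omega : a ≤ a + d + 1), mul_add]
    have : ∑ q ∈ Finset.Icc a (a + d), y ^ (a + d + 1 - q) * x ^ (q + j) =
        y * ∑ q ∈ Finset.Icc a (a + d), y ^ (a + d - q) * x ^ (q + j) := by
      rw [Finset.mul_sum]
      refine Finset.sum_congr rfl fun q hq => ?_
      rw [← mul_assoc, ← pow_succ']
      congr 2
      have := (Finset.mem_Icc.1 hq).2
      omega
    rw [this, mul_left_comm, ← ih]
    rw [show a + d + 1 + 1 - a = d + 2 by omega, show a + d + 1 - a = d + 1 by omega]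
    simp
    ring

/-- The exponents `p_{N - 1 - j} + j` of the alternant belonging to the sequence `p`. -/
def shifted (N : ℕ) (p : ℕ → ℕ) (j : Fin N) : ℕ := p (N - 1 - j) + j

/-- The sequence with the given first `N` values (in reverse order), and `0` afterwards. -/
def revExtend (N : ℕ) (q : Fin N → ℕ) (r : ℕ) : ℕ :=
  if h : r < N then q (Fin.rev ⟨r, h⟩) else 0

/-- The sequences interlacing with `p`. -/
noncomputable def interlacing (N : ℕ) (p : ℕ → ℕ) : Finset (Fin N → ℕ) :=
  Fintype.piFinset fun j : Fin N => Finset.Icc (p (N - j)) (p (N - 1 - j))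

/-- Row operations clear the last column below its top entry, the other columns become divisible by
x_i - x_N, and the cofactor expands by multilinearity over interlacing sequences. It is essential
that `C` does not depend on `p`: comparing `p` with 0 then gives branching for the quotient of
alternants without any division. -/
theorem alternant_succ (x : ℕ → R) (N : ℕ) : ∃ C : R, ∀ p : ℕ → ℕ, Antitone p →
    alternant x (N + 1) (shifted (N + 1) p) =
      C * ∑ q ∈ interlacing N p, x N ^ (p N + ∑ j : Fin N, (p (N - 1 - j) - q j)) *
        alternant x N (shifted N (revExtend N q)) := by
  -- The sign comes from expanding along the last column at its top entry, the product from the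
  -- column factors of the minor.
  refine ⟨(-1) ^ N * ∏ i : Fin N, (x i - x N), fun p hp => ?_⟩
  let B : Matrix (Fin (N + 1)) (Fin (N + 1)) R := Matrix.of fun j i =>
    Fin.cases (x i ^ p N) (fun j : Fin N => (x i - x N) *
      ∑ q ∈ Finset.Icc (p (N - j)) (p (N - 1 - j)), x N ^ (p (N - 1 - j) - q) * x i ^ (q + j)) j
  have hAB : alternant x (N + 1) (shifted (N + 1) p) = B.det := by
    -- From each row a multiple of the preceding row is subtracted, with the power of x_N that makes
    -- the entry in the last column zero.
    refine Matrix.det_eq_of_forall_row_eq_smul_add_pred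
      (fun j : Fin N => x N ^ (p (N - 1 - j) + 1 - p (N - j))) (fun i => ?_) fun j i => ?_
    · simp [B, shifted]
    · simp only [B, Matrix.of_apply, shifted, Fin.cases_succ, Fin.val_succ, Fin.val_castSucc]
      rw [← pow_sub_eq_geom _ _ _ (hp (by omega)), Nat.add_sub_cancel,
        show N - (j + 1) = N - 1 - j by omega]
      ring
  rw [hAB, Matrix.det_succ_column B (Fin.last N), Fin.sum_univ_succ, Finset.sum_eq_zero, add_zero]
  swap
  · intro j _
    simp [B]
  have hM : B.submatrix (Fin.succAbove 0) (Fin.last N).succAbove =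
      Matrix.of fun j i : Fin N => (x i - x N) * (Matrix.of fun j i : Fin N =>
        ∑ q ∈ Finset.Icc (p (N - j)) (p (N - 1 - j)),
          x N ^ (p (N - 1 - j) - q) * x i ^ (q + j)) j i := by
    ext j i
    simp [B]
  rw [hM, Matrix.det_mul_row]
  have hsum : (Matrix.of fun j i : Fin N => ∑ q ∈ Finset.Icc (p (N - j)) (p (N - 1 - j)),
      x N ^ (p (N - 1 - j) - q) * x i ^ (q + j)).det =
      ∑ q ∈ interlacing N p, x N ^ (∑ j : Fin N, (p (N - 1 - j) - q j)) *
        alternant x N (shifted N (revExtend N q)) := by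
    -- Each row is a sum over its own interval, so multilinearity yields a sum over the product of
    -- the intervals, which is `interlacing N p`.
    have h := (Matrix.detRowAlternating (R := R) (n := Fin N)).toMultilinearMap.map_sum_finset
      (fun (j : Fin N) (q : ℕ) (i : Fin N) => x N ^ (p (N - 1 - j) - q) * x i ^ (q + (j : ℕ)))
      (fun j : Fin N => Finset.Icc (p (N - j)) (p (N - 1 - j)))
    refine Eq.trans ?_ (h.trans (Finset.sum_congr rfl fun q _ => ?_))
    · change Matrix.det _ = Matrix.det _
      congr 1
      ext j i
      simp
    · rw [← Finset.prod_pow_eq_pow_sum, alternant, ← Matrix.det_mul_column]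
      change Matrix.det _ = Matrix.det _
      congr 1
      ext j i
      have hj : N - 1 - (j : ℕ) < N := by omega
      have : Fin.rev ⟨N - 1 - (j : ℕ), hj⟩ = j := by
        ext; simp [Fin.val_rev]; omega
      simp [shifted, revExtend, hj, this]
  rw [hsum, Finset.mul_sum, Finset.mul_sum, Finset.mul_sum]
  refine Finset.sum_congr rfl fun q _ => ?_
  rw [pow_add]
  simp [B]
  ring

/-- The Schur polynomial in `x_0, …, x_{N - 1}`, defined by branching. -/
noncomputable def branchSchur (x : ℕ → R) : ℕ → (ℕ → ℕ) → R
  | 0, _ => 1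
  | N + 1, p => ∑ q ∈ interlacing N p, x N ^ (p N + ∑ j : Fin N, (p (N - 1 - j) - q j)) *
      branchSchur x N (revExtend N q)

theorem interlacing_zero (N : ℕ) : interlacing N 0 = {0} := by
  ext q
  simp [interlacing, funext_iff]

theorem revExtend_zero (N : ℕ) : revExtend N 0 = 0 := by
  ext r
  simp [revExtend]

theorem revExtend_antitone {N : ℕ} {p : ℕ → ℕ} {q : Fin N → ℕ} (hq : q ∈ interlacing N p) :
    Antitone (revExtend N q) := by
  refine antitone_nat_of_succ_le fun r => ?_
  simp only [interlacing, Fintype.mem_piFinset, Finset.mem_Icc] at hq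
  unfold revExtend
  split_ifs with h1 h2
  · have a := (hq (Fin.rev ⟨r + 1, h1⟩)).2
    have b := (hq (Fin.rev ⟨r, h2⟩)).1
    simp only [Fin.val_rev] at a b
    rw [show N - 1 - (N - (r + 1 + 1)) = r + 1 by omega] at a
    rw [show N - (N - (r + 1)) = r + 1 by omega] at b
    exact a.trans b
  · omega
  · exact Nat.zero_le _
  · exact le_rfl

/-- The bialternant formula. -/
theorem alternant_shifted (x : ℕ → R) (N : ℕ) (p : ℕ → ℕ) (hp : Antitone p) :
    alternant x N (shifted N p) = branchSchur x N p * alternant x N (shifted N 0) := by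
  induction N generalizing p with
  | zero => simp [alternant, branchSchur]
  | succ N ih =>
    obtain ⟨C, hC⟩ := alternant_succ x N
    have h0 := hC 0 antitone_const
    rw [interlacing_zero, Finset.sum_singleton, revExtend_zero] at h0
    simp only [Pi.zero_apply, Nat.zero_sub, Finset.sum_const_zero, add_zero, pow_zero,
      one_mul] at h0
    rw [hC p hp, h0, branchSchur, Finset.mul_sum, Finset.sum_mul]
    refine Finset.sum_congr rfl fun q hq => ?_
    rw [ih _ (revExtend_antitone hq)]
    ring

end Alternant

/-! ### Vertical strips -/

/-- The step of a walk on strictly increasing exponent vectors that adds a vertical strip of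
size `m t`. -/
def VStep (m : ℕ → ℕ) {N : ℕ} (t : ℕ) (w v : Fin N → ℕ) : Prop :=
  StrictMono v ∧ (∀ j, w j ≤ v j ∧ v j ≤ w j + 1) ∧ ∑ j, v j = ∑ j, w j + m t

theorem finite_vStep (m : ℕ → ℕ) {N : ℕ} (t : ℕ) (v : Fin N → ℕ) :
    {w | VStep m t w v}.Finite := by
  refine (Set.Finite.pi' fun j => Set.finite_Iic (v j)).subset fun w hw j => ?_
  exact (hw.2.1 j).1

open Classical in
/-- The strictly increasing vectors reached by a vertical strip of size `r`. -/
noncomputable def vSucc {N : ℕ} (r : ℕ) (w : Fin N → ℕ) : Finset (Fin N → ℕ) :=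
  {v ∈ Fintype.piFinset fun j => Finset.Icc (w j) (w j + 1) |
    ∑ j, v j = ∑ j, w j + r ∧ StrictMono v}

theorem mem_vSucc (m : ℕ → ℕ) {N : ℕ} (t : ℕ) (w v : Fin N → ℕ) :
    v ∈ vSucc (m t) w ↔ VStep m t w v := by
  simp only [vSucc, VStep, Finset.mem_filter, Fintype.mem_piFinset, Finset.mem_Icc]
  tauto

section Pieri

variable {R : Type*} [CommRing R]

/-- Adding 0 or 1 to the entries of a strictly increasing vector leaves it weakly increasing; if two
entries become equal, the alternant has equal rows and vanishes. -/
theorem esymmFin_mul_alternant_eq_sum (x : ℕ → R) (N r : ℕ) {w : Fin N → ℕ} (hw : StrictMono w) :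
    esymmFin x N r * alternant x N w = ∑ v ∈ vSucc r w, alternant x N v := by
  classical
  rw [esymmFin_mul_alternant, vSucc, ← Finset.filter_filter]
  rw [Finset.sum_filter_of_ne]
  · refine Finset.sum_bij (fun S _ j => w j + if j ∈ S then 1 else 0) (fun S hS => ?_)
      (fun S _ S' _ h => ?_) (fun v hv => ?_) fun S _ => rfl
    · rw [Finset.mem_powersetCard] at hS
      rw [Finset.mem_filter, Fintype.mem_piFinset]
      refine ⟨fun j => ?_, ?_⟩
      · rw [Finset.mem_Icc]
        split_ifs <;> omega
      · rw [Finset.sum_add_distrib, Finset.sum_boole, Finset.filter_mem_eq_inter]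
        simp [hS.2]
    · ext j
      have := congrFun h j
      by_cases h1 : j ∈ S <;> by_cases h2 : j ∈ S' <;> simp_all
    · rw [Finset.mem_filter, Fintype.mem_piFinset] at hv
      have hv' : (fun j => w j + if j ∈ Finset.univ.filter (fun j => v j = w j + 1) then 1 else 0)
          = v := by
        ext j
        have := Finset.mem_Icc.1 (hv.1 j)
        by_cases h : v j = w j + 1
        · simp [h]
        · simp [h]; omega
      refine ⟨Finset.univ.filter fun j => v j = w j + 1, ?_, hv'⟩
      rw [Finset.mem_powersetCard]
      refine ⟨Finset.subset_univ _, ?_⟩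
      have h := hv.2
      conv_lhs at h => rw [← hv']
      rw [Finset.sum_add_distrib, Finset.sum_boole, Finset.filter_mem_eq_inter] at h
      simpa using h
  · intro v hv hne
    rw [Finset.mem_filter, Fintype.mem_piFinset] at hv
    have hinj : Function.Injective v := by
      by_contra h
      exact hne (alternant_eq_zero x h)
    refine Monotone.strictMono_of_injective (fun i j hij => ?_) hinj
    rcases hij.eq_or_lt with rfl | h
    · exact le_rfl
    · have h1 := hw h
      have h2 := Finset.mem_Icc.1 (hv.1 i)
      have h3 := Finset.mem_Icc.1 (hv.1 j)
      omega

/-- Pieri's rule iterated: walk counts satisfy the same recursion as the coefficients. The degree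
clause later identifies the end points as partitions of n. -/
theorem prod_esymmFin_mul_alternant (x : ℕ → R) (N : ℕ) (m : ℕ → ℕ) {u : Fin N → ℕ}
    (hu : StrictMono u) (M : ℕ) :
    ∃ p : (Fin N → ℕ) →₀ ℕ, (∀ v, p v = walkCount (VStep m) u M v) ∧
      (∀ v, p v ≠ 0 → StrictMono v ∧ ∑ j, v j = ∑ j, u j + ∑ t ∈ Finset.range M, m t) ∧
      (∏ t ∈ Finset.range M, esymmFin x N (m t)) * alternant x N u =
        Finsupp.linearCombination ℕ (alternant x N) p := by
  classical
  induction M with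
  | zero =>
    refine ⟨Finsupp.single u 1, fun v => ?_, fun v hv => ?_, by simp⟩
    · rw [walkCount_zero, Finsupp.single_apply]
      simp only [eq_comm]
    · have : u = v := by
        by_contra h
        exact hv (Finsupp.single_eq_of_ne' h)
      subst this
      exact ⟨hu, by simp⟩
  | succ M ih =>
    obtain ⟨p, hp, hp', he⟩ := ih
    have hval : ∀ v, (∑ w ∈ p.support, ∑ v ∈ vSucc (m M) w, Finsupp.single v (p w)) v =
        ∑ w ∈ p.support.filter (fun w => VStep m M w v), p w := by
      intro v
      rw [Finsupp.finsetSum_apply, Finset.sum_filter]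
      refine Finset.sum_congr rfl fun w _ => ?_
      rw [Finsupp.finsetSum_apply]
      simp only [Finsupp.single_apply]
      rw [Finset.sum_ite_eq']
      simp only [mem_vSucc]
    refine ⟨∑ w ∈ p.support, ∑ v ∈ vSucc (m M) w, Finsupp.single v (p w), fun v => ?_,
      fun v hv => ?_, ?_⟩
    · rw [hval, walkCount_succ (finite_vStep m) M v (s := (finite_vStep m M v).toFinset)
        (fun w => by simp)]
      simp only [← hp]
      refine Finset.sum_subset (fun w hw => ?_) fun w hw hw' => ?_
      · simpa using (Finset.mem_filter.1 hw).2
      · simp only [Set.Finite.mem_toFinset, Set.mem_ofPred_eq] at hw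
        by_contra h
        exact hw' (Finset.mem_filter.2 ⟨Finsupp.mem_support_iff.2 h, hw⟩)
    · rw [hval] at hv
      obtain ⟨w, hw, -⟩ := Finset.exists_ne_zero_of_sum_ne_zero hv
      rw [Finset.mem_filter, Finsupp.mem_support_iff] at hw
      refine ⟨hw.2.1, ?_⟩
      rw [hw.2.2.2, (hp' w hw.1).2, Finset.sum_range_succ, add_assoc]
    · rw [Finset.prod_range_succ, mul_right_comm, he, Finsupp.linearCombination_apply, Finsupp.sum,
        Finset.sum_mul, map_sum]
      refine Finset.sum_congr rfl fun w hw => ?_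
      rw [smul_mul_assoc, mul_comm, esymmFin_mul_alternant_eq_sum x N _
        (hp' w (Finsupp.mem_support_iff.1 hw)).1, map_sum, Finset.smul_sum]
      simp

end Pieri

/-! ### Restriction to finitely many variables and division of exponents -/

/-- Setting the variables `x_i` with `i ≥ N` to zero. -/
noncomputable def restrictVars (N : ℕ) (f : MvPowerSeries ℕ ℚ) : MvPowerSeries ℕ ℚ :=
  fun a => open Classical in if ∀ i ∈ a.support, i < N then MvPowerSeries.coeff a f else 0

theorem coeff_restrictVars (N : ℕ) (f : MvPowerSeries ℕ ℚ) (a : ℕ →₀ ℕ) :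
    MvPowerSeries.coeff a (restrictVars N f) =
      open Classical in if ∀ i ∈ a.support, i < N then MvPowerSeries.coeff a f else 0 := rfl

theorem restrictVars_one (N : ℕ) : restrictVars N 1 = 1 := by
  classical
  ext a
  rw [coeff_restrictVars, MvPowerSeries.coeff_one]
  split_ifs with h1 h2 h2
  · rfl
  · rfl
  · subst h2; simp at h1
  · rfl

/-- A monomial of a product involves only x_0, …, x_{N - 1} exactly when both factors do. -/
theorem restrictVars_mul (N : ℕ) (f g : MvPowerSeries ℕ ℚ) :
    restrictVars N (f * g) = restrictVars N f * restrictVars N g := by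
  classical
  ext a
  simp only [coeff_restrictVars, MvPowerSeries.coeff_mul]
  split_ifs with h
  · refine Finset.sum_congr rfl fun p hp => ?_
    rw [Finset.HasAntidiagonal.mem_antidiagonal] at hp
    subst hp
    rw [if_pos, if_pos]
    · exact fun i hi => h i (by simp at hi ⊢; omega)
    · exact fun i hi => h i (by simp at hi ⊢; omega)
  · symm
    refine Finset.sum_eq_zero fun p hp => ?_
    rw [Finset.HasAntidiagonal.mem_antidiagonal] at hp
    subst hp
    by_contra h'
    refine h fun i hi => ?_
    have h1 : ∀ i ∈ p.1.support, i < N := by by_contra h; exact h' (by rw [if_neg h, zero_mul])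
    have h2 : ∀ i ∈ p.2.support, i < N := by by_contra h; exact h' (by rw [if_neg h, mul_zero])
    by_cases h3 : i ∈ p.1.support
    · exact h1 i h3
    · exact h2 i (by simp at h3 hi ⊢; omega)

/-- The exponent vector with the given first `N` entries. -/
noncomputable def finExpo {N : ℕ} (w : Fin N → ℕ) : ℕ →₀ ℕ := ∑ i : Fin N, Finsupp.single (i : ℕ) (w i)

theorem finExpo_apply {N : ℕ} (w : Fin N → ℕ) (r : ℕ) :
    finExpo w r = if h : r < N then w ⟨r, h⟩ else 0 := by
  classical
  rw [finExpo, Finsupp.finsetSum_apply]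
  simp only [Finsupp.single_apply]
  split_ifs with h
  · rw [Finset.sum_eq_single ⟨r, h⟩]
    · simp
    · intro b _ hb
      exact if_neg fun hb' => hb (Fin.ext hb')
    · simp
  · exact Finset.sum_eq_zero fun i _ => if_neg (by omega)

theorem prod_X_pow {N : ℕ} (w : Fin N → ℕ) :
    ∏ i : Fin N, (MvPowerSeries.X (i : ℕ) : MvPowerSeries ℕ ℚ) ^ w i =
      MvPowerSeries.monomial (finExpo w) 1 := by
  classical
  unfold finExpo
  induction (Finset.univ : Finset (Fin N)) using Finset.induction_on with
  | empty => simp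
  | insert i s hi ih =>
    rw [Finset.prod_insert hi, Finset.sum_insert hi, ih, MvPowerSeries.X_pow_eq,
      MvPowerSeries.monomial_mul_monomial, one_mul]

theorem restrictVars_elem (N r : ℕ) :
    restrictVars N (elem r : MvPowerSeries ℕ ℚ) = esymmFin MvPowerSeries.X N r := by
  classical
  have hmon : ∀ S : Finset (Fin N), ∏ i ∈ S, (MvPowerSeries.X (i : ℕ) : MvPowerSeries ℕ ℚ) =
      MvPowerSeries.monomial (finExpo fun i => if i ∈ S then 1 else 0) 1 := by
    intro S
    rw [← prod_X_pow]
    simp only [pow_ite, pow_one, pow_zero, Finset.prod_ite_mem, Finset.univ_inter]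
  have hinj : ∀ S T : Finset (Fin N), finExpo (fun i => if i ∈ S then 1 else 0) =
      finExpo (fun i => if i ∈ T then 1 else 0) → S = T := by
    intro S T h
    ext i
    have := DFunLike.congr_fun h (i : ℕ)
    simp only [finExpo_apply, i.2, dif_pos] at this
    by_cases h1 : i ∈ S <;> by_cases h2 : i ∈ T <;> simp_all
  have hdeg : ∀ S : Finset (Fin N), (finExpo fun i => if i ∈ S then 1 else 0).degree = S.card := by
    intro S
    simp [finExpo, map_sum]
  ext a
  rw [coeff_restrictVars, esymmFin]
  simp only [hmon, map_sum, MvPowerSeries.coeff_monomial]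
  change (if _ then (if a.degree = r ∧ ∀ i, a i ≤ 1 then (1 : ℚ) else 0) else 0) = _
  by_cases h : (∀ i ∈ a.support, i < N) ∧ a.degree = r ∧ ∀ i, a i ≤ 1
  · rw [if_pos h.1, if_pos h.2]
    have ha : a = finExpo (fun i : Fin N => if i ∈ Finset.univ.filter (fun i : Fin N => a i = 1)
        then 1 else 0) := by
      ext i
      rw [finExpo_apply]
      have h1 := h.2.2 i
      split_ifs with h2 h3
      · simpa using h3
      · have : a i ≠ 1 := by simpa using h3
        omega
      · by_contra h3
        exact h2 (h.1 i (by simpa using h3))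
    rw [Finset.sum_eq_single (Finset.univ.filter (fun i : Fin N => a i = 1))]
    · rw [if_pos ha]
    · intro S _ hS
      refine if_neg fun h' => hS ?_
      exact hinj _ _ (h'.symm.trans ha)
    · intro hS
      refine absurd ?_ hS
      rw [Finset.mem_powersetCard]
      refine ⟨Finset.subset_univ _, ?_⟩
      rw [← h.2.1, ← hdeg, ← ha]
  · rw [Finset.sum_eq_zero]
    · split_ifs <;> tauto
    · intro S hS
      refine if_neg fun h' => h ?_
      subst h'
      refine ⟨fun i hi => ?_, ?_, fun i => ?_⟩
      · by_contra h2
        rw [Finsupp.mem_support_iff, finExpo_apply, dif_neg h2] at hi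
        exact hi rfl
      · rw [hdeg, (Finset.mem_powersetCard.1 hS).2]
      · rw [finExpo_apply]
        split_ifs <;> simp

/-- The linear map that keeps the monomials all of whose exponents are divisible by `k`, and
divides the exponents by `k`. -/
noncomputable def divExpo (k : ℕ) : MvPowerSeries ℕ ℚ →ₗ[ℚ] MvPowerSeries ℕ ℚ where
  toFun f := fun a => MvPowerSeries.coeff (k • a) f
  map_add' _ _ := rfl
  map_smul' _ _ := rfl

theorem coeff_divExpo (k : ℕ) (f : MvPowerSeries ℕ ℚ) (a : ℕ →₀ ℕ) :
    MvPowerSeries.coeff a (divExpo k f) = MvPowerSeries.coeff (k • a) f := rfl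

theorem expoType_smul {k : ℕ} (hk : 1 ≤ k) (a : ℕ →₀ ℕ) :
    expoType (k • a) = (expoType a).map (k * ·) := by
  unfold expoType
  rw [Multiset.map_map, Finsupp.support_smul_eq (by omega)]
  rfl

/-- The two linear maps agree on the monomial basis. Unlike `rowDiv`, `divExpo` also applies to
alternants, which are not symmetric. -/
theorem rowDiv_eq_divExpo {k : ℕ} (hk : 1 ≤ k) (f : Symm) :
    (rowDiv k f : MvPowerSeries ℕ ℚ) = divExpo k f := by
  have h : Symm.toSubmodule.subtype ∘ₗ rowDiv k = divExpo k ∘ₗ Symm.toSubmodule.subtype := by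
    refine monomialBasis.ext fun p => ?_
    have hb : monomialBasis p = monomialSymm p.2 := by rw [monomialBasis, Module.Basis.mk_apply]
    rw [hb]
    change (rowDiv k (monomialSymm p.2) : MvPowerSeries ℕ ℚ) =
      divExpo k (monomialSymm p.2 : MvPowerSeries ℕ ℚ)
    rw [rowDiv_monomialSymm]
    ext a
    rw [coeff_divExpo, coeff_monomialSymm, expoType_smul hk]
    split_ifs with h1 h2 h2
    · rw [coeff_monomialSymm]
      refine if_pos ?_
      have h3 : ∀ i ∈ p.2.parts.map (· / k), i ≠ 0 := by
        intro i hi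
        obtain ⟨j, hj, rfl⟩ := Multiset.mem_map.1 hi
        exact (Nat.div_pos (Nat.le_of_dvd (p.2.parts_pos hj) (h1 j hj)) hk).ne'
      change _ = Multiset.filter (· ≠ 0) _
      rw [Multiset.filter_eq_self.2 h3, ← h2, Multiset.map_map]
      conv_lhs => rw [← Multiset.map_id (expoType a)]
      refine Multiset.map_congr rfl fun i _ => ?_
      simp [Nat.mul_div_cancel_left i hk]
    · rw [coeff_monomialSymm]
      refine if_neg fun h3 => h2 ?_
      change _ = Multiset.filter (· ≠ 0) _ at h3
      have h4 : ∀ i ∈ p.2.parts.map (· / k), i ≠ 0 := by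
        intro i hi
        obtain ⟨j, hj, rfl⟩ := Multiset.mem_map.1 hi
        exact (Nat.div_pos (Nat.le_of_dvd (p.2.parts_pos hj) (h1 j hj)) hk).ne'
      rw [Multiset.filter_eq_self.2 h4] at h3
      rw [h3, Multiset.map_map]
      conv_rhs => rw [← Multiset.map_id p.2.parts]
      refine Multiset.map_congr rfl fun i hi => ?_
      exact Nat.mul_div_cancel' (h1 i hi)
    · refine absurd ?_ h1
      intro i hi
      rw [← h2] at hi
      obtain ⟨j, -, rfl⟩ := Multiset.mem_map.1 hi
      exact Dvd.intro _ rfl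
    · rfl
  exact LinearMap.congr_fun h f

theorem alternant_X (N : ℕ) (v : Fin N → ℕ) :
    alternant (MvPowerSeries.X : ℕ → MvPowerSeries ℕ ℚ) N v =
      ∑ σ : Equiv.Perm (Fin N), (Equiv.Perm.sign σ : ℤ) •
        MvPowerSeries.monomial (finExpo (v ∘ σ)) (1 : ℚ) := by
  rw [alternant_eq_sum]
  refine Finset.sum_congr rfl fun σ _ => ?_
  rw [← prod_X_pow]
  rfl

theorem finExpo_smul (k : ℕ) {N : ℕ} (w : Fin N → ℕ) :
    finExpo (fun j => k * w j) = k • finExpo w := by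
  ext i
  simp only [Finsupp.smul_apply, finExpo_apply, smul_eq_mul]
  split_ifs <;> simp

/-- A monomial whose exponents are multiples of k does not affect the divisibility of the remaining
exponents, so it can be pulled out. -/
theorem divExpo_mul_monomial {k : ℕ} (hk : 1 ≤ k) (f : MvPowerSeries ℕ ℚ) (b : ℕ →₀ ℕ) :
    divExpo k (f * MvPowerSeries.monomial (k • b) 1) =
      divExpo k f * MvPowerSeries.monomial b 1 := by
  ext a
  simp only [coeff_divExpo, MvPowerSeries.coeff_mul_monomial]
  have h : k • b ≤ k • a ↔ b ≤ a := by
    simp only [Finsupp.le_def, Finsupp.smul_apply, smul_eq_mul]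
    exact forall_congr' fun i => Nat.mul_le_mul_left_iff hk
  simp only [h]
  have h' : k • a - k • b = k • (a - b) := by
    ext i
    simp [Nat.mul_sub]
  rw [h']

theorem divExpo_mul_alternant {k : ℕ} (hk : 1 ≤ k) (f : MvPowerSeries ℕ ℚ) {N : ℕ}
    (v : Fin N → ℕ) :
    divExpo k (f * alternant MvPowerSeries.X N (fun j => k * v j)) =
      divExpo k f * alternant MvPowerSeries.X N v := by
  rw [alternant_X, alternant_X, Finset.mul_sum, Finset.mul_sum, map_sum]
  refine Finset.sum_congr rfl fun σ _ => ?_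
  rw [mul_smul_comm, mul_smul_comm, map_zsmul, ← divExpo_mul_monomial hk]
  congr 3
  rw [← finExpo_smul]
  rfl

theorem divExpo_alternant_mul {k : ℕ} (hk : 1 ≤ k) {N : ℕ} (v : Fin N → ℕ) :
    divExpo k (alternant MvPowerSeries.X N (fun j => k * v j)) =
      alternant MvPowerSeries.X N v := by
  classical
  have h := divExpo_mul_alternant hk 1 v
  have h1 : divExpo k 1 = 1 := by
    ext a
    rw [coeff_divExpo, MvPowerSeries.coeff_one, MvPowerSeries.coeff_one]
    congr 1
    rw [smul_eq_zero_iff_right (by omega)]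
  rwa [one_mul, h1, one_mul] at h

/-- Every monomial of the alternant carries a permutation of the same exponents, one of which is not
divisible by k. -/
theorem divExpo_alternant_of_not_dvd {k : ℕ} {N : ℕ} {v : Fin N → ℕ} (h : ¬ ∀ j, k ∣ v j) :
    divExpo k (alternant MvPowerSeries.X N v) = 0 := by
  classical
  rw [alternant_X, map_sum]
  refine Finset.sum_eq_zero fun σ _ => ?_
  rw [map_zsmul]
  refine (congrArg _ ?_).trans (smul_zero _)
  ext a
  rw [coeff_divExpo, MvPowerSeries.coeff_monomial, if_neg, map_zero]
  intro h'
  refine h fun j => ?_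
  have := DFunLike.congr_fun h' ((σ⁻¹ j : Fin N) : ℕ)
  rw [finExpo_apply, dif_pos (σ⁻¹ j).2] at this
  simp only [Finsupp.smul_apply, smul_eq_mul, Fin.eta, Function.comp_apply,
    Equiv.Perm.inv_def, Equiv.apply_symm_apply] at this
  exact ⟨_, this.symm⟩

/-- This is a Vandermonde determinant in distinct variables over a domain; it is what allows the
final cancellation. -/
theorem alternant_X_ne_zero (N : ℕ) :
    alternant (MvPowerSeries.X : ℕ → MvPowerSeries ℕ ℚ) N (shifted N 0) ≠ 0 := by
  have h : alternant (MvPowerSeries.X : ℕ → MvPowerSeries ℕ ℚ) N (shifted N 0) =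
      (Matrix.vandermonde fun i : Fin N => (MvPowerSeries.X (i : ℕ) : MvPowerSeries ℕ ℚ)).det := by
    rw [← Matrix.det_transpose]
    congr 1
    ext i
    simp [shifted]
  have : IsDomain (MvPowerSeries ℕ ℚ) := NoZeroDivisors.to_isDomain _
  rw [h, Matrix.det_vandermonde_ne_zero_iff]
  intro i j hij
  exact Fin.ext (MvPowerSeries.X_inj.1 hij)

/-! ### Partitions as sequences -/

/-- A downward closed predicate cuts out an initial segment. This produces the number of nonzero
parts, the row lengths of a chain, and the entries of a tableau. -/
theorem exists_threshold (p : ℕ → Prop) (M : ℕ) (hp : ∀ a b, a ≤ b → b < M → p b → p a) :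
    ∃ m ≤ M, ∀ n < M, n < m ↔ p n := by
  induction M with
  | zero => exact ⟨0, le_rfl, by simp⟩
  | succ M ih =>
    by_cases h : p M
    · exact ⟨M + 1, le_rfl, fun n hn => ⟨fun _ => hp n M (by omega) (by omega) h, fun _ => hn⟩⟩
    · obtain ⟨m, hm, hm'⟩ := ih fun a b hab hb => hp a b hab (by omega)
      refine ⟨m, by omega, fun n hn => ?_⟩
      rcases Nat.lt_succ_iff_lt_or_eq.1 hn with hn | rfl
      · exact hm' n hn
      · exact ⟨fun h' => absurd h' (by omega), fun h' => absurd h' h⟩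

theorem expo_apply {n : ℕ} (p : n.Partition) (r : ℕ) : expo p r = part p r := rfl

theorem length_partsList {n : ℕ} (p : n.Partition) : (partsList p).length = len p :=
  Multiset.length_sort _

theorem part_eq_zero {n : ℕ} (p : n.Partition) {r : ℕ} (hr : len p ≤ r) : part p r = 0 :=
  List.getD_eq_default _ _ (by rwa [length_partsList])

theorem degree_expo {n : ℕ} (p : n.Partition) : (expo p).degree = n := by
  rw [← expoType_sum, expoType_expo, p.parts_sum]

theorem sum_part {n : ℕ} (p : n.Partition) {N : ℕ} (hN : len p ≤ N) :
    ∑ r ∈ Finset.range N, part p r = n := by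
  conv_rhs => rw [← degree_expo p]
  change _ = ∑ r ∈ (expo p).support, part p r
  refine (Finset.sum_subset (fun r hr => ?_) fun r _ hr => ?_).symm
  · rw [Finset.mem_range]
    by_contra h
    exact (Finsupp.mem_support_iff.1 hr) (part_eq_zero p (by omega))
  · exact Finsupp.notMem_support_iff.1 hr

theorem len_le {n : ℕ} (p : n.Partition) : len p ≤ n := by
  have h : p.parts.card • 1 ≤ p.parts.sum :=
    Multiset.card_nsmul_le_sum fun x hx => p.parts_pos hx
  rwa [p.parts_sum, smul_eq_mul, mul_one] at h

theorem part_injective {n : ℕ} : Function.Injective (part : n.Partition → ℕ → ℕ) := by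
  intro p q h
  have : expo p = expo q := Finsupp.ext fun r => congrFun h r
  refine Nat.Partition.ext ?_
  rw [← expoType_expo p, this, expoType_expo]

theorem exists_partition {n N : ℕ} {q : ℕ → ℕ} (hq : Antitone q) (h0 : ∀ r, N ≤ r → q r = 0)
    (hn : ∑ r ∈ Finset.range N, q r = n) : ∃ p : n.Partition, part p = q := by
  obtain ⟨m, hm, hm'⟩ := exists_threshold (fun r => q r ≠ 0) N fun a b hab _ hb ha =>
    hb (by have := hq hab; omega)
  have hz : ∀ r, m ≤ r → q r = 0 := by
    intro r hr
    rcases lt_or_ge r N with h | h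
    · by_contra h'
      have := (hm' r h).2 h'
      omega
    · exact h0 r h
  refine ⟨⟨((List.range m).map q : List ℕ), fun {i} hi => ?_, ?_⟩, funext fun r => ?_⟩
  · simp only [Multiset.mem_coe, List.mem_map, List.mem_range] at hi
    obtain ⟨r, hr, rfl⟩ := hi
    exact Nat.pos_of_ne_zero ((hm' r (by omega)).1 hr)
  · change (∑ r ∈ Finset.range m, q r) = _
    rw [← hn]
    refine Finset.sum_subset (Finset.range_mono hm) fun r _ hr => hz r (by simpa using hr)
  · have hs : ((List.range m).map q).Pairwise (· ≥ ·) :=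
      List.pairwise_map.2 (List.pairwise_lt_range.imp fun h => hq h.le)
    have hl : Multiset.sort (((List.range m).map q : List ℕ) : Multiset ℕ) (· ≥ ·) =
        (List.range m).map q := by
      refine List.Perm.eq_of_pairwise' (Multiset.pairwise_sort _ _) hs ?_
      rw [← Multiset.coe_eq_coe, Multiset.sort_eq]
    change (Multiset.sort (((List.range m).map q : List ℕ) : Multiset ℕ) (· ≥ ·)).getD r 0 = _
    rw [hl]
    rcases lt_or_ge r m with h | h
    · rw [List.getD_eq_getElem _ _ (by simpa using h)]
      simp
    · rw [List.getD_eq_default _ _ (by simpa using h), hz r h]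

theorem strictMono_add_le {N : ℕ} {v : Fin N → ℕ} (hv : StrictMono v) {i j : Fin N} (hij : i ≤ j) :
    v i + (j - i : ℕ) ≤ v j := by
  obtain ⟨i, hi⟩ := i
  obtain ⟨j, hj⟩ := j
  have hij' : i ≤ j := hij
  obtain ⟨d, rfl⟩ := Nat.exists_eq_add_of_le hij'
  clear hij hij'
  induction d with
  | zero => simp
  | succ d ih =>
    have h1 := ih (by omega)
    have h2 : v ⟨i + d, by omega⟩ < v ⟨i + (d + 1), hj⟩ := hv (by simp)
    dsimp only at h1 ⊢
    omega

theorem shifted_strictMono (N : ℕ) {p : ℕ → ℕ} (hp : Antitone p) : StrictMono (shifted N p) := by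
  intro i j hij
  have h1 : (i : ℕ) < j := hij
  have := hp (show N - 1 - (j : ℕ) ≤ N - 1 - i by omega)
  unfold shifted
  omega

theorem shifted_injOn {N : ℕ} {p q : ℕ → ℕ} (hp : ∀ r, N ≤ r → p r = 0)
    (hq : ∀ r, N ≤ r → q r = 0) (h : shifted N p = shifted N q) : p = q := by
  funext r
  rcases lt_or_ge r N with hr | hr
  · have := congrFun h ⟨N - 1 - r, by omega⟩
    simp only [shifted] at this
    rw [show N - 1 - (N - 1 - r) = r by omega] at this
    omega
  · rw [hp r hr, hq r hr]

theorem sum_shifted (N : ℕ) (p : ℕ → ℕ) :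
    ∑ j, shifted N p j = ∑ r ∈ Finset.range N, p r + ∑ j : Fin N, (j : ℕ) := by
  unfold shifted
  rw [Finset.sum_add_distrib, ← Finset.sum_range_reflect, ← Fin.sum_univ_eq_sum_range
    (fun j => p (N - 1 - j))]

/-- Since v increases strictly, v_j - j increases weakly; read backwards it is the partition. -/
theorem exists_partition_shifted {N n : ℕ} {v : Fin N → ℕ} (hv : StrictMono v)
    (hs : ∑ j, v j = n + ∑ j : Fin N, (j : ℕ)) : ∃ p : n.Partition, shifted N (part p) = v := by
  let q : ℕ → ℕ := fun r => if h : r < N then v ⟨N - 1 - r, by omega⟩ - (N - 1 - r) else 0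
  have hq : Antitone q := by
    intro a b hab
    dsimp only [q]
    split_ifs with h1 h2
    · have := strictMono_add_le hv (i := ⟨N - 1 - b, by omega⟩) (j := ⟨N - 1 - a, by omega⟩)
        (by simp only [Fin.mk_le_mk]; omega)
      simp only at this
      omega
    · omega
    · exact Nat.zero_le _
    · exact le_rfl
  have hsq : shifted N q = v := by
    funext j
    have hj := j.2
    have h1 := strictMono_add_le hv (i := ⟨0, by omega⟩) (j := j) (Fin.mk_le_mk.2 (Nat.zero_le _))
    have h2 : (⟨N - 1 - (N - 1 - (j : ℕ)), by omega⟩ : Fin N) = j := Fin.ext (by dsimp; omega)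
    simp only [shifted, q]
    rw [dif_pos (by omega), h2]
    simp only [Nat.sub_zero] at h1
    omega
  have hn : ∑ r ∈ Finset.range N, q r = n := by
    have := sum_shifted N q
    rw [hsq, hs] at this
    omega
  obtain ⟨p, hp⟩ := exists_partition hq (fun r hr => dif_neg (by omega)) hn
  exact ⟨p, by rw [hp, hsq]⟩

/-! ### The expansion of `ρ_k (e_μ)` in terms of walks -/

theorem restrictVars_elemPartition (N : ℕ) {n : ℕ} (μ : n.Partition) :
    restrictVars N (elemPartition μ : MvPowerSeries ℕ ℚ) =
      ∏ t ∈ Finset.range (len μ), esymmFin MvPowerSeries.X N (part μ t) := by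
  have hl : (μ.parts : Multiset ℕ) = ((List.range (len μ)).map (part μ) : List ℕ) := by
    rw [← Multiset.sort_eq μ.parts (· ≥ ·)]
    congr 1
    refine List.ext_getElem (by simp [len]) fun i h1 h2 => ?_
    rw [List.getElem_map, List.getElem_range, part]
    exact (List.getD_eq_getElem _ _ h1).symm
  let φ : Symm →* MvPowerSeries ℕ ℚ :=
    { toFun f := restrictVars N f
      map_one' := restrictVars_one N
      map_mul' f g := restrictVars_mul N f g }
  change φ (elemPartition μ) = _
  rw [elemPartition, map_multiset_prod, hl, Multiset.map_map, Multiset.map_coe, List.map_map]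
  change (∏ t ∈ Finset.range (len μ), φ (elem (part μ t))) = _
  exact Finset.prod_congr rfl fun t _ => restrictVars_elem N _

theorem divExpo_restrictVars_elemPartition {k n N : ℕ} (hk : 1 ≤ k) (hN : n ≤ N)
    (μ : (k * n).Partition) :
    divExpo k (restrictVars N (elemPartition μ : MvPowerSeries ℕ ℚ)) =
      ∑ lam : n.Partition, walkCount (VStep (part μ)) (fun j : Fin N => k * shifted N 0 j) (len μ)
        (fun j => k * shifted N (part lam) j) • branchSchur MvPowerSeries.X N (part lam) := by
  classical
  -- After multiplication by a_δ, the left factor is absorbed into `divExpo` as a_{kδ}, where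
  -- Pieri's rule applies.
  refine mul_right_cancel₀ (alternant_X_ne_zero N) ?_
  have hlen : ∀ lam : n.Partition, len lam ≤ N := fun lam => (len_le lam).trans hN
  have hk0 : StrictMono fun j : Fin N => k * shifted N 0 j := fun i j hij =>
    Nat.mul_lt_mul_of_pos_left (shifted_strictMono N antitone_const hij) hk
  rw [← divExpo_mul_alternant hk, restrictVars_elemPartition]
  obtain ⟨p, hp, hp', he⟩ := prod_esymmFin_mul_alternant (MvPowerSeries.X : ℕ → MvPowerSeries ℕ ℚ) N
    (part μ) hk0 (len μ)
  let φ : n.Partition → Fin N → ℕ := fun lam j => k * shifted N (part lam) j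
  have hφ : Function.Injective φ := by
    intro a b hab
    refine part_injective (shifted_injOn (N := N) (fun r hr => part_eq_zero a ((hlen a).trans hr))
      (fun r hr => part_eq_zero b ((hlen b).trans hr)) (funext fun j => ?_))
    exact Nat.eq_of_mul_eq_mul_left hk (congrFun hab j)
  -- The sum is enlarged to contain all k(λ + δ), including those that no walk reaches; every other
  -- term is killed by `divExpo`.
  rw [he, Finsupp.linearCombination_apply, Finsupp.sum, map_sum, Finset.sum_mul,
    Finset.sum_subset (Finset.subset_union_left (s₂ := Finset.univ.image φ))]
  · symm
    refine Finset.sum_of_injOn φ hφ.injOn (fun lam _ => ?_) (fun v hv hv' => ?_) fun lam _ => ?_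
    · simp
    · rw [map_nsmul]
      by_contra hne
      have h1 : p v ≠ 0 := fun h => hne (by rw [h, zero_smul])
      have h2 : ∀ j, k ∣ v j := by
        by_contra h
        exact hne (by rw [divExpo_alternant_of_not_dvd h, smul_zero])
      choose w hw using h2
      obtain ⟨h3, h4⟩ := hp' v h1
      have h5 : StrictMono w := fun i j hij => by
        have := h3 hij
        rw [hw i, hw j] at this
        exact lt_of_mul_lt_mul_left' this
      -- The parts of μ add up to kn, so dividing the degree identity by k leaves n for the size of
      -- the partition.
      have h6 : ∑ j, w j = n + ∑ j : Fin N, (j : ℕ) := by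
        rw [sum_part μ le_rfl] at h4
        simp only [hw] at h4
        rw [← Finset.mul_sum, ← Finset.mul_sum, sum_shifted] at h4
        simp only [Pi.zero_apply, Finset.sum_const_zero, zero_add] at h4
        rw [← mul_add, add_comm] at h4
        exact Nat.eq_of_mul_eq_mul_left hk h4
      obtain ⟨lam, hlam⟩ := exists_partition_shifted h5 h6
      refine hv' ⟨lam, by simp, funext fun j => ?_⟩
      simp only [φ, hlam, hw]
    · rw [map_nsmul, divExpo_alternant_mul hk, smul_mul_assoc, ← alternant_shifted _ _ _
        (part_antitone lam), hp]
  · intro v _ hv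
    rw [Finsupp.notMem_support_iff.1 hv, zero_smul, map_zero]

theorem coeff_rowDiv_elemPartition {k n N : ℕ} (hk : 1 ≤ k) (hN : n ≤ N)
    (μ : (k * n).Partition) {a : ℕ →₀ ℕ} (ha : ∀ i ∈ a.support, i < N) :
    MvPowerSeries.coeff a (rowDiv k (elemPartition μ) : MvPowerSeries ℕ ℚ) =
      ∑ lam : n.Partition, (walkCount (VStep (part μ)) (fun j : Fin N => k * shifted N 0 j) (len μ)
        (fun j => k * shifted N (part lam) j) : ℚ) *
          MvPowerSeries.coeff a (branchSchur MvPowerSeries.X N (part lam)) := by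
  have h := congrArg (MvPowerSeries.coeff a) (divExpo_restrictVars_elemPartition hk hN μ)
  rw [coeff_divExpo, coeff_restrictVars, if_pos, ← coeff_divExpo, ← rowDiv_eq_divExpo hk,
    map_sum] at h
  · rw [h]
    refine Finset.sum_congr rfl fun lam _ => ?_
    rw [map_nsmul, nsmul_eq_mul]
  · intro i hi
    exact ha i (Finsupp.support_smul hi)

/-! ### Horizontal strips -/

theorem walkCount_congr {V : Type*} {Step Step' : ℕ → V → V → Prop} (u : V) {M : ℕ} (v : V)
    (h : ∀ t < M, Step t = Step' t) : walkCount Step u M v = walkCount Step' u M v := by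
  unfold walkCount
  congr 2
  funext g
  unfold IsWalk
  have : (∀ t < M, Step t (g t) (g (t + 1))) = ∀ t < M, Step' t (g t) (g (t + 1)) :=
    forall_congr fun t => forall_congr fun ht => by rw [h t ht]
  rw [this]

/-- The step from `w` to `v` of a Gelfand–Tsetlin pattern: `w` interlaces with `v`, it has at most
`t` nonzero terms and the sums differ by `a t`. -/
def HStep (a : ℕ →₀ ℕ) (t : ℕ) (w v : ℕ → ℕ) : Prop :=
  (∀ r, v (r + 1) ≤ w r ∧ w r ≤ v r) ∧ (∀ r, t ≤ r → w r = 0) ∧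
    ∑ r ∈ Finset.range (t + 1), v r = ∑ r ∈ Finset.range t, w r + a t

theorem revExtend_val_rev {N : ℕ} (q : Fin N → ℕ) (j : Fin N) :
    revExtend N q (Fin.rev j : Fin N) = q j :=
  (dif_pos (Fin.rev j).2).trans (congrArg q (Fin.rev_rev j))

theorem revExtend_injective (N : ℕ) : Function.Injective (revExtend N) := by
  intro q q' h
  ext j
  rw [← revExtend_val_rev q j, h, revExtend_val_rev]

theorem revExtend_rev {N : ℕ} (w : ℕ → ℕ) (hw : ∀ r, N ≤ r → w r = 0) :
    revExtend N (fun j => w (N - 1 - j)) = w := by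
  ext r
  unfold revExtend
  split_ifs with h
  · dsimp only
    rw [Fin.val_rev]
    congr 1
    dsimp only
    omega
  · exact (hw r (by omega)).symm

theorem sum_revExtend {N : ℕ} (q : Fin N → ℕ) :
    ∑ r ∈ Finset.range N, revExtend N q r = ∑ j, q j := by
  rw [← Fin.sum_univ_eq_sum_range, ← Equiv.sum_comp Fin.revPerm]
  refine Finset.sum_congr rfl fun j _ => ?_
  exact revExtend_val_rev q j

theorem finite_hStep (a : ℕ →₀ ℕ) (t : ℕ) (v : ℕ → ℕ) : {w | HStep a t w v}.Finite := by
  refine Set.Finite.subset (Set.Finite.image (revExtend t)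
    (Set.Finite.pi' fun j : Fin t => Set.finite_Iic (v (t - 1 - j)))) fun w hw => ?_
  exact ⟨_, fun j => (hw.1 _).2, revExtend_rev w hw.2.1⟩

/-- One term of the branching sum is one step of a pattern: the exponent of x_N there is the
difference of the two sizes. -/
theorem hStep_revExtend_iff (a : ℕ →₀ ℕ) (N : ℕ) {p : ℕ → ℕ} (hp : ∀ r, N < r → p r = 0)
    (w : ℕ → ℕ) : HStep a N w p ↔ ∃ q ∈ interlacing N p,
      a N = p N + ∑ j : Fin N, (p (N - 1 - j) - q j) ∧ revExtend N q = w := by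
  have hsum : ∀ q ∈ interlacing N p, ∑ r ∈ Finset.range (N + 1), p r =
      ∑ r ∈ Finset.range N, revExtend N q r + (p N + ∑ j : Fin N, (p (N - 1 - j) - q j)) := by
    intro q hq
    have h1 : ∑ r ∈ Finset.range N, p r =
        ∑ j : Fin N, q j + ∑ j : Fin N, (p (N - 1 - j) - q j) := by
      rw [← Finset.sum_add_distrib, ← Finset.sum_range_reflect,
        ← Fin.sum_univ_eq_sum_range (fun j => p (N - 1 - j))]
      refine Finset.sum_congr rfl fun j _ => ?_
      have := (Finset.mem_Icc.1 (Fintype.mem_piFinset.1 hq j)).2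
      omega
    rw [Finset.sum_range_succ, sum_revExtend, h1]
    ring
  constructor
  · rintro ⟨h1, h2, h3⟩
    have hq : (fun j : Fin N => w (N - 1 - j)) ∈ interlacing N p := by
      refine Fintype.mem_piFinset.2 fun j => Finset.mem_Icc.2 ?_
      have := h1 (N - 1 - j)
      rwa [show N - 1 - (j : ℕ) + 1 = N - j by omega] at this
    refine ⟨_, hq, ?_, revExtend_rev w h2⟩
    have := hsum _ hq
    rw [revExtend_rev w h2] at this
    omega
  · rintro ⟨q, hq, h1, rfl⟩
    refine ⟨fun r => ?_, fun r hr => dif_neg (by omega), by rw [h1, hsum q hq]⟩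
    unfold revExtend
    split_ifs with h
    · have := Finset.mem_Icc.1 (Fintype.mem_piFinset.1 hq (Fin.rev ⟨r, h⟩))
      rw [Fin.val_rev] at this
      dsimp only at this
      rwa [show N - (N - (r + 1)) = r + 1 by omega,
        show N - 1 - (N - (r + 1)) = r by omega] at this
    · rw [hp (r + 1) (by omega)]
      exact ⟨le_rfl, Nat.zero_le _⟩

/-- Unfolding the branching recursion gives one pattern per contributing term, the exponent of x_t
being the growth in step t. -/
theorem coeff_branchSchur (N : ℕ) (p : ℕ → ℕ) (hp : ∀ r, N ≤ r → p r = 0) (a : ℕ →₀ ℕ) :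
    MvPowerSeries.coeff a (branchSchur (MvPowerSeries.X : ℕ → MvPowerSeries ℕ ℚ) N p) =
      open Classical in if ∀ i ∈ a.support, i < N then (walkCount (HStep a) 0 N p : ℚ) else 0 := by
  classical
  induction N generalizing p a with
  | zero =>
    have hp0 : p = 0 := funext fun r => hp r (Nat.zero_le _)
    rw [branchSchur, MvPowerSeries.coeff_one, walkCount_zero, if_pos hp0, Nat.cast_one]
    refine if_congr ?_ rfl rfl
    simp [Finsupp.ext_iff]
  | succ N ih =>
    have key : ∀ q ∈ interlacing N p, MvPowerSeries.coeff a ((MvPowerSeries.X N : MvPowerSeries ℕ ℚ)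
        ^ (p N + ∑ j : Fin N, (p (N - 1 - j) - q j)) *
          branchSchur MvPowerSeries.X N (revExtend N q)) =
        if ∀ i ∈ a.support, i < N + 1 then
          if a N = p N + ∑ j : Fin N, (p (N - 1 - j) - q j) then
            (walkCount (HStep a) 0 N (revExtend N q) : ℚ) else 0 else 0 := by
      intro q hq
      generalize p N + ∑ j : Fin N, (p (N - 1 - j) - q j) = d
      rw [MvPowerSeries.X_pow_eq, MvPowerSeries.coeff_monomial_mul, one_mul,
        ih _ (fun r hr => dif_neg (by omega))]
      have hval : ∀ i, (a - Finsupp.single N d) i = if i = N then a N - d else a i := by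
        intro i
        rw [Finsupp.tsub_apply, Finsupp.single_apply]
        split_ifs with h1 h2 h2
        · rw [h1]
        · exact absurd h1.symm h2
        · exact absurd h2.symm h1
        · rfl
      -- A walk of N steps only sees the exponents with index below N, so removing the power of x_N
      -- changes nothing.
      have hwc : walkCount (HStep (a - Finsupp.single N d)) 0 N (revExtend N q) =
          walkCount (HStep a) 0 N (revExtend N q) := by
        refine walkCount_congr _ _ fun t ht => ?_
        unfold HStep
        rw [hval, if_neg ht.ne]
      rw [hwc, ← ite_and, ← ite_and]
      refine if_congr ?_ rfl rfl
      rw [Finsupp.single_le_iff]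
      constructor
      · rintro ⟨h1, h2⟩
        have h3 : a N = d := by
          by_contra h
          exact lt_irrefl N (h2 N (by rw [Finsupp.mem_support_iff, hval, if_pos rfl]; omega))
        refine ⟨fun i hi => ?_, h3⟩
        rcases eq_or_ne i N with rfl | h
        · omega
        · refine (h2 i ?_).trans (Nat.lt_succ_self N)
          rw [Finsupp.mem_support_iff, hval, if_neg h]
          exact Finsupp.mem_support_iff.1 hi
      · rintro ⟨h1, h2⟩
        refine ⟨h2.ge, fun i hi => ?_⟩
        rw [Finsupp.mem_support_iff, hval] at hi
        split_ifs at hi with h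
        · omega
        · have := h1 i (Finsupp.mem_support_iff.2 hi)
          omega
    rw [branchSchur, map_sum, Finset.sum_congr rfl key]
    split_ifs with hs
    · rw [← Finset.sum_filter, walkCount_succ (finite_hStep a) N p
        (s := ((interlacing N p).filter fun q =>
          a N = p N + ∑ j : Fin N, (p (N - 1 - j) - q j)).image (revExtend N)) (fun w => ?_),
        Finset.sum_image (revExtend_injective N).injOn, Nat.cast_sum]
      rw [hStep_revExtend_iff a N (fun r hr => hp r hr), Finset.mem_image]
      simp only [Finset.mem_filter, and_assoc]
    · exact Finset.sum_const_zero

/-! ### Tableaux with weakly increasing rows as chains of shapes -/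

/-- `T` is a filling of the cells `(r, c)`, `lo r ≤ c < hi r`, with entries less than `M` that
weakly increase along rows. -/
def IsRowFilling (lo hi : ℕ → ℕ) (M : ℕ) (T : ℕ → ℕ → ℕ) : Prop :=
  (∀ r c, ¬ (lo r ≤ c ∧ c < hi r) → T r c = 0) ∧
    (∀ r c c', lo r ≤ c → c ≤ c' → c' < hi r → T r c ≤ T r c') ∧
    ∀ r c, lo r ≤ c → c < hi r → T r c < M

/-- `g` is a chain of row length sequences from `lo` to `hi`. -/
abbrev IsRowChain (lo hi : ℕ → ℕ) (M : ℕ) (g : ℕ → ℕ → ℕ) : Prop :=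
  IsWalk (fun _ w v => w ≤ v) lo M hi g

/-- The `t`-th term of the chain `g` consists of the cells with entries less than `t`. -/
def Corresponds (lo hi : ℕ → ℕ) (T g : ℕ → ℕ → ℕ) : Prop :=
  ∀ r c t, lo r ≤ c → c < hi r → (T r c < t ↔ c < g t r)

section RowFilling

variable {lo hi : ℕ → ℕ} {M : ℕ} {T g : ℕ → ℕ → ℕ}

theorem IsWalk.monotone (hg : IsRowChain lo hi M g) : Monotone g := by
  refine monotone_nat_of_le_succ fun t => ?_
  rcases lt_or_ge t M with h | h
  · exact hg.2.1 t h
  · rw [hg.2.2 t h, hg.2.2 (t + 1) (by omega)]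

theorem IsWalk.lo_le (hg : IsRowChain lo hi M g) (t r : ℕ) : lo r ≤ g t r := by
  rw [← hg.1]
  exact hg.monotone (Nat.zero_le t) r

theorem IsWalk.le_hi (hg : IsRowChain lo hi M g) (t r : ℕ) : g t r ≤ hi r := by
  rw [← hg.2.2 (max t M) (le_max_right _ _)]
  exact hg.monotone (le_max_left _ _) r

theorem exists_rowChain (hle : lo ≤ hi) (hT : IsRowFilling lo hi M T) :
    ∃ g, IsRowChain lo hi M g ∧ Corresponds lo hi T g := by
  -- The disjunct `c < lo r` includes the removed inner cells, so that the cells counted form an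
  -- initial segment of the row.
  have h := fun t r => exists_threshold (fun c => c < lo r ∨ T r c < t) (hi r) (by
    intro a b hab hb h
    rcases lt_or_ge a (lo r) with ha | ha
    · exact Or.inl ha
    · refine Or.inr ((hT.2.1 r a b ha hab hb).trans_lt (h.resolve_left (by omega))))
  choose g hg hg' using h
  have hlo : ∀ t r, lo r ≤ g t r := by
    intro t r
    by_contra h
    have := (hg' t r (g t r) (by have : lo r ≤ hi r := hle r; omega)).2 (Or.inl (by omega))
    omega
  refine ⟨g, ⟨?_, ?_, ?_⟩, ?_⟩
  · funext r
    refine le_antisymm ?_ (hlo 0 r)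
    by_contra h
    have h1 := hg 0 r
    have := (hg' 0 r (lo r) (by omega)).1 (by omega)
    omega
  · intro t _ r
    change g t r ≤ g (t + 1) r
    by_contra h
    have h1 := hg t r
    have h2 := (hg' t r (g (t + 1) r) (by omega)).1 (by omega)
    have h3 := (hg' (t + 1) r (g (t + 1) r) (by omega)).2 (by omega)
    omega
  · intro t ht
    funext r
    refine le_antisymm (hg t r) ?_
    by_contra h
    have h2 := hT.2.2 r (g t r) (hlo t r) (by omega)
    have h3 := (hg' t r (g t r) (by omega)).2 (by omega)
    omega
  · intro r c t h1 h2
    rw [hg' t r c h2]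
    constructor
    · exact Or.inr
    · intro h
      exact h.resolve_left (by omega)

theorem exists_rowFilling (hg : IsRowChain lo hi M g) :
    ∃ T, IsRowFilling lo hi M T ∧ Corresponds lo hi T g := by
  -- The entry of a cell is the first step of the chain at which the cell is covered.
  have h := fun r c => exists_threshold (fun t => g (t + 1) r ≤ c) M
    (fun a b hab _ h => (hg.monotone (Nat.add_le_add_right hab 1) r).trans h)
  choose T hT hT' using h
  have hc : ∀ r c t, lo r ≤ c → c < hi r → (T r c < t ↔ c < g t r) := by
    intro r c t h1 h2
    cases t with
    | zero => rw [hg.1]; omega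
    | succ t =>
      rcases lt_or_ge t M with h | h
      · have := hT' r c t h
        omega
      · rw [hg.2.2 (t + 1) (by omega)]
        have := hT r c
        omega
  classical
  refine ⟨fun r c => if lo r ≤ c ∧ c < hi r then T r c else 0, ⟨fun r c h => if_neg h, ?_, ?_⟩, ?_⟩
  · intro r c c' h1 h2 h3
    dsimp only
    rw [if_pos ⟨h1, by omega⟩, if_pos ⟨by omega, h3⟩]
    have := (hc r c' (T r c' + 1) (by omega) h3).1 (Nat.lt_succ_self _)
    have := (hc r c (T r c' + 1) h1 (by omega)).2 (by omega)
    omega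
  · intro r c h1 h2
    dsimp only
    rw [if_pos ⟨h1, h2⟩, hc r c M h1 h2, hg.2.2 M le_rfl]
    exact h2
  · intro r c t h1 h2
    dsimp only
    rw [if_pos ⟨h1, h2⟩, hc r c t h1 h2]

theorem Corresponds.filling_unique {T' : ℕ → ℕ → ℕ} (hT : IsRowFilling lo hi M T)
    (hT' : IsRowFilling lo hi M T') (h : Corresponds lo hi T g) (h' : Corresponds lo hi T' g) :
    T = T' := by
  funext r c
  by_cases hc : lo r ≤ c ∧ c < hi r
  · refine eq_of_forall_gt_iff fun t => ?_
    rw [h r c t hc.1 hc.2, h' r c t hc.1 hc.2]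
  · rw [hT.1 r c hc, hT'.1 r c hc]

theorem Corresponds.chain_unique {g' : ℕ → ℕ → ℕ} (hg : IsRowChain lo hi M g)
    (hg' : IsRowChain lo hi M g') (h : Corresponds lo hi T g) (h' : Corresponds lo hi T g') :
    g = g' := by
  funext t r
  have h1 := hg.lo_le t r
  have h2 := hg'.lo_le t r
  have h3 := hg.le_hi t r
  have h4 := hg'.le_hi t r
  rcases lt_trichotomy (g t r) (g' t r) with h5 | h5 | h5
  · have := (h r (g t r) t h1 (by omega)).1 ((h' r (g t r) t h1 (by omega)).2 h5)
    omega
  · exact h5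
  · have := (h' r (g' t r) t h2 (by omega)).1 ((h r (g' t r) t h2 (by omega)).2 h5)
    omega

/-- A filling and its chain determine each other, so a condition on columns or content may be
translated for a single corresponding pair. It serves both for ordinary tableaux and for the
stretched skew shapes. -/
theorem card_rowFilling (hle : lo ≤ hi) {P Q : (ℕ → ℕ → ℕ) → Prop}
    (h : ∀ T g, IsRowFilling lo hi M T → IsRowChain lo hi M g → Corresponds lo hi T g →
      (P T ↔ Q g)) :
    Nat.card {T // IsRowFilling lo hi M T ∧ P T} = Nat.card {g // IsRowChain lo hi M g ∧ Q g} := by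
  choose f hf hf' using fun T (hT : IsRowFilling lo hi M T) => exists_rowChain hle hT
  choose e he he' using fun g (hg : IsRowChain lo hi M g) => exists_rowFilling hg
  exact Nat.card_congr
    { toFun T := ⟨f T.1 T.2.1, hf _ _, (h _ _ T.2.1 (hf _ _) (hf' _ _)).1 T.2.2⟩
      invFun g := ⟨e g.1 g.2.1, he _ _, (h _ _ (he _ _) g.2.1 (he' _ _)).2 g.2.2⟩
      left_inv T := Subtype.ext
        (Corresponds.filling_unique (he _ _) T.2.1 (he' _ _) (hf' _ T.2.1))
      right_inv g := Subtype.ext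
        (Corresponds.chain_unique (hf _ _) g.2.1 (hf' _ _) (he' _ g.2.1)) }

/-- The number of entries equal to `t` is the difference of two consecutive shapes. -/
theorem Corresponds.content_apply (hg : IsRowChain lo hi M g) (h : Corresponds lo hi T g)
    {cells : Finset (ℕ × ℕ)} (hcells : ∀ r c, (r, c) ∈ cells ↔ lo r ≤ c ∧ c < hi r) {R : ℕ}
    (hR : ∀ r, R ≤ r → hi r = 0) (t : ℕ) :
    ∑ r ∈ Finset.range R, g (t + 1) r =
      ∑ r ∈ Finset.range R, g t r + (∑ c ∈ cells, Finsupp.single (T c.1 c.2) 1 : ℕ →₀ ℕ) t := by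
  classical
  rw [Finsupp.finsetSum_apply, Finset.sum_finset_product cells (Finset.range R)
    (fun r => Finset.Ico (lo r) (hi r)), ← Finset.sum_add_distrib]
  · refine Finset.sum_congr rfl fun r _ => ?_
    have hm : g t r ≤ g (t + 1) r := hg.monotone (Nat.le_succ t) r
    have h1 := hg.lo_le t r
    have h2 := hg.le_hi (t + 1) r
    have : ∑ c ∈ Finset.Ico (lo r) (hi r), (Finsupp.single (T r c) 1 : ℕ →₀ ℕ) t =
        (Finset.Ico (g t r) (g (t + 1) r)).card := by
      simp only [Finsupp.single_apply]
      rw [Finset.sum_boole, Nat.cast_id]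
      congr 1
      ext c
      rw [Finset.mem_filter, Finset.mem_Ico, Finset.mem_Ico]
      constructor
      · rintro ⟨⟨h3, h4⟩, h5⟩
        have h6 := h r c t h3 h4
        have h7 := h r c (t + 1) h3 h4
        omega
      · rintro ⟨h3, h4⟩
        have h6 := h r c t (by omega) (by omega)
        have h7 := h r c (t + 1) (by omega) (by omega)
        omega
    rw [this, Nat.card_Ico]
    omega
  · rintro ⟨r, c⟩
    rw [hcells, Finset.mem_range, Finset.mem_Ico]
    refine ⟨fun h => ⟨?_, h⟩, fun h => h.2⟩
    by_contra h'
    have := hR r (by omega)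
    omega

end RowFilling

/-! ### Schur functions through Gelfand–Tsetlin patterns -/

theorem mem_rowDiagram {l : ℕ} {f : ℕ → ℕ} {hf : Antitone f} {r c : ℕ} :
    (r, c) ∈ rowDiagram l f hf ↔ r < l ∧ c < f r := by
  unfold rowDiagram
  rw [YoungDiagram.mem_ofRowLens]
  simp

theorem mem_diagram {n : ℕ} (p : n.Partition) {r c : ℕ} : (r, c) ∈ diagram p ↔ c < part p r := by
  unfold diagram
  rw [mem_rowDiagram]
  refine ⟨And.right, fun h => ⟨?_, h⟩⟩
  by_contra h'
  rw [part_eq_zero p (by omega)] at h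
  omega

theorem entry_lt_of_content {cells : Finset (ℕ × ℕ)} {T : ℕ → ℕ → ℕ} {a : ℕ →₀ ℕ} {N : ℕ}
    (ha : ∀ i ∈ a.support, i < N) (h : ∑ c ∈ cells, Finsupp.single (T c.1 c.2) 1 = a)
    {c : ℕ × ℕ} (hc : c ∈ cells) : T c.1 c.2 < N := by
  classical
  refine ha _ (Finsupp.mem_support_iff.2 ?_)
  rw [← h, Finsupp.finsetSum_apply]
  intro h0
  have := (Finset.sum_eq_zero_iff.1 h0) c hc
  simp at this

/-- Semistandard tableaux as Gelfand–Tsetlin patterns. -/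
theorem card_semistandard {n N : ℕ} (p : n.Partition) (hN : n ≤ N) {a : ℕ →₀ ℕ}
    (ha : ∀ i ∈ a.support, i < N) :
    Nat.card {T : SemistandardYoungTableau (diagram p) // content T = a} =
      walkCount (HStep a) 0 N (part p) := by
  have hanti := part_antitone p
  have hz : ∀ r, N ≤ r → part p r = 0 := fun r hr => part_eq_zero p (by have := len_le p; omega)
  have hcells : ∀ r c, (r, c) ∈ (diagram p).cells ↔ (0 : ℕ → ℕ) r ≤ c ∧ c < part p r := by
    intro r c
    rw [YoungDiagram.mem_cells, mem_diagram]
    simp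
  have hP := card_rowFilling (lo := 0) (hi := part p) (M := N) (fun r => Nat.zero_le _)
    (P := fun T => (∀ r r' c, r < r' → c < part p r' → T r c < T r' c) ∧
      ∑ c ∈ (diagram p).cells, Finsupp.single (T c.1 c.2) 1 = a)
    (Q := IsWalk (HStep a) 0 N (part p)) (by
      intro T g hT hg hc
      have hcont := fun t => hc.content_apply hg hcells hz t
      constructor
      · rintro ⟨hcol, rfl⟩
        -- If this failed, the cell (r + 1, g t r) would have an entry at most t below an entry at
        -- least t, against strict increase in the column.
        have hint : ∀ t r, g (t + 1) (r + 1) ≤ g t r := by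
          intro t r
          by_contra h
          have h1 := hg.le_hi (t + 1) (r + 1)
          have h2 := hanti (Nat.le_succ r)
          simp only [Nat.succ_eq_add_one] at h2
          have h3 := (hc (r + 1) (g t r) (t + 1) (Nat.zero_le _) (by omega)).2 (by omega)
          have h4 := hcol r (r + 1) (g t r) (by omega) (by omega)
          have h5 := (hc r (g t r) t (Nat.zero_le _) (by omega)).1 (by omega)
          omega
        have hgz : ∀ t r, t ≤ r → g t r = 0 := by
          intro t
          induction t with
          | zero => intro r _; rw [hg.1]; rfl
          | succ t ih =>
            intro r hr
            obtain ⟨r, rfl⟩ := Nat.exists_eq_add_of_le' (show 1 ≤ r by omega)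
            have := hint t r
            rw [ih r (by omega)] at this
            omega
        refine ⟨hg.1, fun t ht => ⟨fun r => ⟨hint t r, hg.2.1 t ht r⟩, hgz t, ?_⟩, hg.2.2⟩
        have h1 := hcont t
        rw [← Finset.sum_subset (Finset.range_mono ht) fun r _ hr => hgz _ r (by simpa using hr)]
          at h1
        rw [← Finset.sum_subset (Finset.range_mono ht.le) fun r _ hr => hgz _ r (by simpa using hr)]
          at h1
        exact h1
      · intro hw
        -- Once the cell in row r + 1 is covered, interlacing forces the cell above it to have been
        -- covered one step earlier.
        have hadj : ∀ r c, c < part p (r + 1) → T r c < T (r + 1) c := by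
          intro r c h
          have h1 := hT.2.2 (r + 1) c (Nat.zero_le _) h
          have h2 := (hc (r + 1) c (T (r + 1) c + 1) (Nat.zero_le _) h).1 (Nat.lt_succ_self _)
          have h3 := ((hw.2.1 _ h1).1 r).1
          exact (hc r c _ (Nat.zero_le _) (h.trans_le (hanti (Nat.le_succ r)))).2 (by omega)
        refine ⟨fun r r' c hr h => ?_, Finsupp.ext fun t => ?_⟩
        · obtain ⟨d, rfl⟩ := Nat.exists_eq_add_of_le (Nat.succ_le_of_lt hr)
          clear hr
          induction d with
          | zero => exact hadj r c h
          | succ d ih =>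
            exact (ih (h.trans_le (hanti (by omega)))).trans (hadj _ c h)
        · have h1 := hcont t
          rcases lt_or_ge t N with ht | ht
          · have hgz : ∀ s ≤ N, ∀ r, s ≤ r → g s r = 0 := by
              intro s hs r hr
              rcases hs.eq_or_lt with rfl | hs
              · rw [hg.2.2 s le_rfl, hz r hr]
              · exact (hw.2.1 s hs).2.1 r hr
            have h2 := (hw.2.1 t ht).2.2
            rw [← Finset.sum_subset (Finset.range_mono ht)
              fun r _ hr => hgz _ ht r (by simpa using hr)] at h1
            rw [← Finset.sum_subset (Finset.range_mono ht.le)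
              fun r _ hr => hgz _ ht.le r (by simpa using hr)] at h1
            simp only [Nat.succ_eq_add_one] at h1
            omega
          · rw [hg.2.2 t ht, hg.2.2 (t + 1) (by omega)] at h1
            have h2 : a t = 0 := by
              by_contra h
              have := ha t (Finsupp.mem_support_iff.2 h)
              omega
            omega)
  have hQ : Nat.card {g // IsRowChain 0 (part p) N g ∧ IsWalk (HStep a) 0 N (part p) g} =
      walkCount (HStep a) 0 N (part p) :=
    Nat.card_congr (Equiv.subtypeEquivRight fun g => and_iff_right_of_imp fun h =>
      ⟨h.1, fun t ht r => ((h.2.1 t ht).1 r).2, h.2.2⟩)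
  rw [← hQ, ← hP]
  refine Nat.card_congr
    { toFun T := ⟨T.1.entry, ⟨fun r c h => T.1.zeros' (by
          rw [mem_diagram]; simpa using h), fun r c c' _ h1 h2 => ?_, fun r c _ h => ?_⟩,
            fun r r' c h1 h2 => T.1.col_strict' h1 ((mem_diagram p).2 h2), T.2⟩
      invFun T := ⟨⟨T.1, fun h1 h2 => T.2.1.2.1 _ _ _ (Nat.zero_le _) h1.le ((mem_diagram p).1 h2),
        fun h1 h2 => T.2.2.1 _ _ _ h1 ((mem_diagram p).1 h2),
        fun h => T.2.1.1 _ _ (by rw [mem_diagram] at h; simpa using h)⟩, T.2.2.2⟩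
      left_inv T := rfl
      right_inv T := rfl }
  · rcases h1.eq_or_lt with rfl | h1
    · exact le_rfl
    · exact T.1.row_weak' h1 ((mem_diagram p).2 h2)
  · exact entry_lt_of_content (T := T.1.entry) (c := (r, c)) ha T.2 ((mem_diagram p).2 h)

theorem coeff_schur {n N : ℕ} (p : n.Partition) (hN : n ≤ N) {a : ℕ →₀ ℕ}
    (ha : ∀ i ∈ a.support, i < N) : MvPowerSeries.coeff a (schur p) =
      MvPowerSeries.coeff a (branchSchur (MvPowerSeries.X : ℕ → MvPowerSeries ℕ ℚ) N (part p)) := by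
  rw [coeff_branchSchur N _ (fun r hr => part_eq_zero p (by have := len_le p; omega)), if_pos ha,
    ← card_semistandard p hN ha]
  rfl

/-! ### Tableaux of stretched shape -/

/-- The first column of the `r`-th row of the stretched shape. -/
def stretchedLo (k : ℕ) {n : ℕ} (p : n.Partition) (r : ℕ) : ℕ := (k - 1) * (len p - 1 - r)

/-- The end of the `r`-th row of the stretched shape. -/
def stretchedHi (k : ℕ) {n : ℕ} (p : n.Partition) (r : ℕ) : ℕ := k * part p r + stretchedLo k p r

theorem stretchedLo_eq_zero (k : ℕ) {n : ℕ} (p : n.Partition) {r : ℕ} (hr : len p ≤ r + 1) :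
    stretchedLo k p r = 0 := by
  rw [stretchedLo, show len p - 1 - r = 0 by omega, mul_zero]

theorem stretchedHi_eq_zero (k : ℕ) {n : ℕ} (p : n.Partition) {r : ℕ} (hr : len p ≤ r) :
    stretchedHi k p r = 0 := by
  rw [stretchedHi, stretchedLo_eq_zero k p (by omega), part_eq_zero p hr, mul_zero]

/-- Only an inequality, since the truncated `len p - 1 - r` stays 0 on the empty rows beyond the
last part. -/
theorem stretchedLo_le_add (k : ℕ) {n : ℕ} (p : n.Partition) {r r' : ℕ} (h : r' ≤ r) :
    stretchedLo k p r' ≤ stretchedLo k p r + (k - 1) * (r - r') := by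
  unfold stretchedLo
  rw [← mul_add]
  exact Nat.mul_le_mul_left _ (by omega)

theorem stretchedLo_antitone (k : ℕ) {n : ℕ} (p : n.Partition) : Antitone (stretchedLo k p) :=
  fun _ _ h => Nat.mul_le_mul_left _ (by omega)

theorem stretchedHi_antitone (k : ℕ) {n : ℕ} (p : n.Partition) : Antitone (stretchedHi k p) :=
  fun _ _ h => Nat.add_le_add (Nat.mul_le_mul_left _ (part_antitone p h))
    (stretchedLo_antitone k p h)

theorem stretchedLo_le_hi (k : ℕ) {n : ℕ} (p : n.Partition) : stretchedLo k p ≤ stretchedHi k p :=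
  fun _ => Nat.le_add_left _ _

theorem mem_stretchedShape (k : ℕ) {n : ℕ} (p : n.Partition) (r c : ℕ) :
    (r, c) ∈ (stretchedShape k p).cells ↔ stretchedLo k p r ≤ c ∧ c < stretchedHi k p r := by
  have h1 : (r, c) ∈ (stretchedShape k p).outer ↔ r < len p ∧ c < stretchedHi k p r :=
    mem_rowDiagram (hf := stretchedHi_antitone k p)
  have h2 : (r, c) ∈ (stretchedShape k p).inner ↔ r < len p ∧ c < stretchedLo k p r :=
    mem_rowDiagram (hf := stretchedLo_antitone k p)
  rw [SkewShape.cells, Finset.mem_sdiff, YoungDiagram.mem_cells, YoungDiagram.mem_cells, h1, h2]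
  constructor
  · omega
  · intro h
    have : r < len p := by
      by_contra h'
      have := stretchedHi_eq_zero k p (show len p ≤ r by omega)
      omega
    omega

theorem card_stretchedShape (k : ℕ) {n : ℕ} (p : n.Partition) :
    (stretchedShape k p).cells.card = k * n := by
  rw [Finset.card_eq_sum_ones, Finset.sum_finset_product _ (Finset.range (len p))
    (fun r => Finset.Ico (stretchedLo k p r) (stretchedHi k p r))]
  · conv_rhs => rw [← sum_part p le_rfl, Finset.mul_sum]
    refine Finset.sum_congr rfl fun r _ => ?_
    rw [← Finset.card_eq_sum_ones, Nat.card_Ico, stretchedHi, Nat.add_sub_cancel]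
  · rintro ⟨r, c⟩
    rw [mem_stretchedShape, Finset.mem_range, Finset.mem_Ico]
    refine ⟨fun h => ⟨?_, h⟩, fun h => h.2⟩
    by_contra h'
    have := stretchedHi_eq_zero k p (show len p ≤ r by omega)
    dsimp only at *
    omega

theorem SkewShape.mem_transpose_cells (A : SkewShape) (r c : ℕ) :
    (c, r) ∈ A.transpose.cells ↔ (r, c) ∈ A.cells := by
  simp [SkewShape.cells, SkewShape.transpose]

theorem SkewShape.sum_transpose_cells {X : Type*} [AddCommMonoid X] (A : SkewShape)
    (f : ℕ → ℕ → X) : ∑ c ∈ A.transpose.cells, f c.1 c.2 = ∑ c ∈ A.cells, f c.2 c.1 :=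
  Finset.sum_equiv (Equiv.prodComm ℕ ℕ) (fun x => (A.mem_transpose_cells x.2 x.1)) fun _ _ => rfl

/-- The chains of shapes that correspond to tableaux of transposed stretched shape and type `μ`. -/
def IsColumnStrictChain (N : ℕ) {m : ℕ} (μ : m.Partition) (g : ℕ → ℕ → ℕ) : Prop :=
  (∀ t, Antitone (g t)) ∧ ∀ t < len μ, (∀ r, g (t + 1) r ≤ g t r + 1) ∧
    ∑ r ∈ Finset.range N, g (t + 1) r = ∑ r ∈ Finset.range N, g t r + part μ t

/-- Transposing makes rows strict and columns weak. Strict rows say that a step adds at most one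
cell to each row; weak columns say that every member of the chain is a partition shape. -/
theorem kostka_eq_card_chain (k : ℕ) {n m N : ℕ} (p : n.Partition) (μ : m.Partition) (hN : n ≤ N) :
    kostka (stretchedShape k p).transpose μ =
      Nat.card {g // IsRowChain (stretchedLo k p) (stretchedHi k p) (len μ) g ∧
        IsColumnStrictChain N μ g} := by
  have hlo := stretchedLo_antitone k p
  have hhi := stretchedHi_antitone k p
  have hz : ∀ r, N ≤ r → stretchedHi k p r = 0 := fun r hr =>
    stretchedHi_eq_zero k p (by have := len_le p; omega)
  have hcells := mem_stretchedShape k p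
  have hsupp : ∀ i ∈ (expo μ).support, i < len μ := by
    intro i hi
    by_contra h
    exact (Finsupp.mem_support_iff.1 hi) (part_eq_zero μ (by omega))
  rw [← card_rowFilling (stretchedLo_le_hi k p)
    (P := fun T => (∀ r r' c, r < r' → (r, c) ∈ (stretchedShape k p).cells →
      (r', c) ∈ (stretchedShape k p).cells → T r c ≤ T r' c) ∧
      (∀ r c c', c < c' → (r, c) ∈ (stretchedShape k p).cells →
      (r, c') ∈ (stretchedShape k p).cells → T r c < T r c') ∧
      ∑ c ∈ (stretchedShape k p).cells, Finsupp.single (T c.1 c.2) 1 = expo μ)]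
  · refine Nat.card_congr
      { toFun T := ⟨fun r c => T.1.entry c r, ⟨fun r c h => T.1.zeros ?_, ?_, ?_⟩,
          fun r r' c h1 h2 h3 => T.1.row_weak h1 ((SkewShape.mem_transpose_cells _ _ _).2 h2)
            ((SkewShape.mem_transpose_cells _ _ _).2 h3),
          fun r c c' h1 h2 h3 => T.1.col_strict h1 ((SkewShape.mem_transpose_cells _ _ _).2 h2)
            ((SkewShape.mem_transpose_cells _ _ _).2 h3), ?_⟩
        invFun T := ⟨⟨fun c r => T.1 r c,
          fun h1 h2 h3 => T.2.2.1 _ _ _ h1 ((SkewShape.mem_transpose_cells _ _ _).1 h2)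
            ((SkewShape.mem_transpose_cells _ _ _).1 h3),
          fun h1 h2 h3 => T.2.2.2.1 _ _ _ h1 ((SkewShape.mem_transpose_cells _ _ _).1 h2)
            ((SkewShape.mem_transpose_cells _ _ _).1 h3),
          fun h => T.2.1.1 _ _ (by rwa [SkewShape.mem_transpose_cells, hcells] at h)⟩, ?_⟩
        left_inv T := rfl
        right_inv T := rfl }
    · rwa [SkewShape.mem_transpose_cells, hcells]
    · intro r c c' h1 h2 h3
      rcases h2.eq_or_lt with rfl | h2
      · exact le_rfl
      · exact (T.1.col_strict h2 ((SkewShape.mem_transpose_cells _ _ _).2 ((hcells _ _).2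
          ⟨h1, by omega⟩)) ((SkewShape.mem_transpose_cells _ _ _).2 ((hcells _ _).2
          ⟨by omega, h3⟩))).le
    · intro r c h1 h2
      exact entry_lt_of_content (T := T.1.entry) (c := (c, r)) hsupp T.2
        ((SkewShape.mem_transpose_cells _ _ _).2 ((hcells _ _).2 ⟨h1, h2⟩))
    · exact ((stretchedShape k p).sum_transpose_cells
        fun c r => (Finsupp.single (T.1.entry c r) 1 : ℕ →₀ ℕ)).symm.trans T.2
    · exact ((stretchedShape k p).sum_transpose_cells
        fun c r => (Finsupp.single (T.1 r c) 1 : ℕ →₀ ℕ)).trans T.2.2.2.2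
  · intro T g hT hg hc
    have hcont := fun t => hc.content_apply hg hcells hz t
    simp only [hcells]
    constructor
    · rintro ⟨hcol, hrow, he⟩
      refine ⟨fun t => antitone_nat_of_succ_le fun r => ?_, fun t ht => ⟨fun r => ?_, ?_⟩⟩
      · by_contra h
        have h1 := hg.le_hi t (r + 1)
        have h2 := hg.lo_le t r
        have h3 := hlo (Nat.le_succ r)
        have h4 := hhi (Nat.le_succ r)
        simp only [Nat.succ_eq_add_one] at h3 h4
        have h5 := (hc (r + 1) (g t r) t (by omega) (by omega)).2 (by omega)
        have h6 := hcol r (r + 1) (g t r) (by omega) ⟨h2, by omega⟩ ⟨by omega, by omega⟩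
        have h7 := (hc r (g t r) t h2 (by omega)).1 (by omega)
        omega
      · by_contra h
        have h1 := hg.le_hi (t + 1) r
        have h2 := hg.lo_le t r
        have h3 := hc r (g t r) t h2 (by omega)
        have h4 := hc r (g t r + 1) (t + 1) (by omega) (by omega)
        have h5 := hrow r (g t r) (g t r + 1) (by omega) ⟨h2, by omega⟩ ⟨by omega, by omega⟩
        omega
      · rw [hcont t, he, expo_apply]
    · rintro ⟨hanti, hstep⟩
      refine ⟨fun r r' c h1 h2 h3 => ?_, fun r c c' h1 h2 h3 => ?_, Finsupp.ext fun t => ?_⟩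
      · have h4 := (hc r' c (T r' c + 1) h3.1 h3.2).1 (Nat.lt_succ_self _)
        have h5 := (hc r c (T r' c + 1) h2.1 h2.2).2 (h4.trans_le (hanti _ h1.le))
        omega
      · have h4 := (hc r c' (T r c' + 1) h3.1 h3.2).1 (Nat.lt_succ_self _)
        have h5 := (hstep _ (hT.2.2 r c' h3.1 h3.2)).1 r
        exact (hc r c (T r c') h2.1 h2.2).2 (by omega)
      · have h1 := hcont t
        rw [expo_apply]
        rcases lt_or_ge t (len μ) with ht | ht
        · have := (hstep t ht).2
          omega
        · rw [hg.2.2 t ht, hg.2.2 (t + 1) (by omega)] at h1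
          rw [part_eq_zero μ ht]
          omega

theorem sum_fin_rev (N : ℕ) (f : ℕ → ℕ) :
    ∑ j : Fin N, f (N - 1 - j) = ∑ r ∈ Finset.range N, f r := by
  rw [← Finset.sum_range_reflect, ← Fin.sum_univ_eq_sum_range (fun j => f (N - 1 - j))]

/-- Here `w` records the cells added to each row. With r = N - 1 - j, the vector `v` has offset k(N
- 1 - r) where `g` has (k - 1)(ℓ - 1 - r); for r < ℓ these differ by N - 1 - r plus a constant. So
strict increase of `v` matches weak decrease of `g`, while step conditions only involve `w`. -/
theorem isColumnStrictChain_iff {k n m N : ℕ} (hk : 1 ≤ k) (p : n.Partition) (μ : m.Partition)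
    (hN : n ≤ N) {g w : ℕ → ℕ → ℕ} {v : ℕ → Fin N → ℕ}
    (hg : ∀ t r, g t r = stretchedLo k p r + w t r) (hv : ∀ t j, v t j = k * j + w t (N - 1 - j))
    (hw : ∀ t r, N ≤ r → w t r = 0) :
    (IsRowChain (stretchedLo k p) (stretchedHi k p) (len μ) g ∧ IsColumnStrictChain N μ g) ↔
      IsWalk (VStep (part μ)) (fun j : Fin N => k * shifted N 0 j) (len μ)
        (fun j => k * shifted N (part p) j) v := by
  have hlen := len_le p
  have hsv : ∀ t, ∑ j, v t j = ∑ j : Fin N, k * (j : ℕ) + ∑ r ∈ Finset.range N, w t r := by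
    intro t
    simp only [hv]
    rw [Finset.sum_add_distrib, sum_fin_rev N (w t)]
  have hsg : ∀ t, ∑ r ∈ Finset.range N, g t r =
      ∑ r ∈ Finset.range N, stretchedLo k p r + ∑ r ∈ Finset.range N, w t r := by
    intro t
    simp only [hg]
    rw [Finset.sum_add_distrib]
  have hv' : ∀ t r (h : r < N), v t ⟨N - 1 - r, by omega⟩ = k * (N - 1 - r) + w t r := by
    intro t r h
    rw [hv]
    dsimp only
    rw [show N - 1 - (N - 1 - r) = r by omega]
  constructor
  · rintro ⟨hc, hanti, hstep⟩
    refine ⟨funext fun j => ?_, fun t ht => ⟨fun i j hij => ?_, fun j => ?_, ?_⟩, fun t ht => ?_⟩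
    · have h1 := hg 0 (N - 1 - j)
      rw [hc.1] at h1
      rw [hv]
      simp only [shifted, Pi.zero_apply, zero_add]
      omega
    · have hij' : (i : ℕ) < j := hij
      have hj := j.2
      have h1 := hanti (t + 1) (show N - 1 - (j : ℕ) ≤ N - 1 - i by omega)
      have h2 := stretchedLo_le_add k p (show N - 1 - (j : ℕ) ≤ N - 1 - i by omega)
      rw [hg, hg] at h1
      rw [hv, hv]
      obtain ⟨d, hd⟩ := Nat.exists_eq_add_of_lt hij'
      obtain ⟨k, rfl⟩ := Nat.exists_eq_add_of_le' hk
      rw [show N - 1 - (i : ℕ) - (N - 1 - j) = d + 1 by omega, Nat.add_sub_cancel] at h2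
      have h3 : (k + 1) * (j : ℕ) = (k + 1) * i + k * (d + 1) + (d + 1) := by
        rw [hd]; ring
      omega
    · have h1 := hc.2.1 t ht (N - 1 - j)
      have h2 := (hstep t ht).1 (N - 1 - j)
      dsimp only at h1
      rw [hg, hg] at h1 h2
      rw [hv, hv]
      omega
    · have := (hstep t ht).2
      rw [hsg, hsg] at this
      rw [hsv, hsv]
      omega
    · funext j
      have h1 := hg t (N - 1 - j)
      rw [hc.2.2 t ht, stretchedHi] at h1
      rw [hv, shifted, mul_add]
      omega
  · intro h
    have hc : IsRowChain (stretchedLo k p) (stretchedHi k p) (len μ) g := by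
      refine ⟨funext fun r => ?_, fun t ht r => ?_, fun t ht => funext fun r => ?_⟩
      · rw [hg]
        rcases lt_or_ge r N with hr | hr
        · have h1 := hv' 0 r hr
          rw [h.1] at h1
          simp only [shifted, Pi.zero_apply, zero_add] at h1
          omega
        · rw [hw 0 r hr, add_zero]
      · dsimp only
        rw [hg, hg]
        rcases lt_or_ge r N with hr | hr
        · have h1 := ((h.2.1 t ht).2.1 ⟨N - 1 - r, by omega⟩).1
          rw [hv' _ _ hr, hv' _ _ hr] at h1
          omega
        · rw [hw _ r hr, hw _ r hr]
      · rw [hg, stretchedHi]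
        rcases lt_or_ge r N with hr | hr
        · have h1 := hv' t r hr
          rw [h.2.2 t ht] at h1
          simp only [shifted] at h1
          rw [show N - 1 - (N - 1 - r) = r by omega, mul_add] at h1
          omega
        · rw [hw t r hr, part_eq_zero p (by omega)]
          omega
    have hstrict : ∀ t, StrictMono (v t) := by
      have h1 : ∀ t ≤ len μ, StrictMono (v t) := by
        rintro (_ | t) ht
        · rw [h.1]
          intro i j hij
          exact Nat.mul_lt_mul_of_pos_left (shifted_strictMono N antitone_const hij) hk
        · exact (h.2.1 t ht).1
      intro t
      rcases le_total t (len μ) with ht | ht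
      · exact h1 t ht
      · rw [h.2.2 t ht, ← h.2.2 (len μ) le_rfl]
        exact h1 _ le_rfl
    refine ⟨hc, fun t => antitone_nat_of_succ_le fun r => ?_, fun t ht => ⟨fun r => ?_, ?_⟩⟩
    · rcases lt_or_ge (r + 1) (len p) with hr | hr
      · have h1 := hstrict t (a := ⟨N - 1 - (r + 1), by omega⟩) (b := ⟨N - 1 - r, by omega⟩)
          (by rw [Fin.mk_lt_mk]; omega)
        rw [hv' t (r + 1) (by omega), hv' t r (by omega)] at h1
        have h2 : stretchedLo k p r = stretchedLo k p (r + 1) + (k - 1) := by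
          unfold stretchedLo
          rw [show len p - 1 - r = len p - 1 - (r + 1) + 1 by omega, mul_add, mul_one]
        have h3 : k * (N - 1 - r) = k * (N - 1 - (r + 1)) + k := by
          rw [show N - 1 - r = N - 1 - (r + 1) + 1 by omega, mul_add, mul_one]
        rw [hg, hg]
        omega
      · have h1 := hc.le_hi t (r + 1)
        rw [stretchedHi_eq_zero k p hr] at h1
        omega
    · rw [hg, hg]
      rcases lt_or_ge r N with hr | hr
      · have h1 := ((h.2.1 t ht).2.1 ⟨N - 1 - r, by omega⟩).2
        rw [hv' _ _ hr, hv' _ _ hr] at h1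
        omega
      · rw [hw _ r hr, hw _ r hr]
        omega
    · have h1 := (h.2.1 t ht).2.2
      rw [hsv, hsv] at h1
      rw [hsg, hsg]
      omega

theorem kostka_eq_walkCount {k n m N : ℕ} (hk : 1 ≤ k) (p : n.Partition) (μ : m.Partition)
    (hN : n ≤ N) : kostka (stretchedShape k p).transpose μ =
      walkCount (VStep (part μ)) (fun j : Fin N => k * shifted N 0 j) (len μ)
        (fun j => k * shifted N (part p) j) := by
  rw [kostka_eq_card_chain k p μ hN]
  have hlen := len_le p
  -- Walks never go below kδ, so the truncated subtractions in the bijection are exact.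
  have hle : ∀ v, IsWalk (VStep (part μ)) (fun j : Fin N => k * shifted N 0 j) (len μ)
      (fun j => k * shifted N (part p) j) v → ∀ t (j : Fin N), k * j ≤ v t j := by
    intro v hv t j
    have h1 : ∀ t ≤ len μ, k * j ≤ v t j := by
      intro t
      induction t with
      | zero =>
        intro _
        rw [hv.1]
        simp [shifted]
      | succ t ih => exact fun ht => (ih (by omega)).trans ((hv.2.1 t ht).2.1 j).1
    rcases le_total t (len μ) with ht | ht
    · exact h1 t ht
    · rw [hv.2.2 t ht, ← hv.2.2 (len μ) le_rfl]
      exact h1 _ le_rfl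
  have e1 : ∀ g, IsRowChain (stretchedLo k p) (stretchedHi k p) (len μ) g → ∀ t r, N ≤ r →
      g t r - stretchedLo k p r = 0 := by
    intro g hg t r hr
    have h := hg.le_hi t r
    rw [stretchedHi_eq_zero k p (by omega)] at h
    omega
  refine Nat.card_congr
    { toFun g := ⟨fun t j => k * j + (g.1 t (N - 1 - j) - stretchedLo k p (N - 1 - j)),
        (isColumnStrictChain_iff hk p μ hN (w := fun t r => g.1 t r - stretchedLo k p r)
          (fun t r => (Nat.add_sub_cancel' (g.2.1.lo_le t r)).symm) (fun _ _ => rfl)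
          (e1 g.1 g.2.1)).1 g.2⟩
      invFun v := ⟨fun t r => stretchedLo k p r +
          if h : r < N then v.1 t ⟨N - 1 - r, by omega⟩ - k * (N - 1 - r) else 0,
        (isColumnStrictChain_iff hk p μ hN (v := v.1) (fun t r => rfl) (fun t j => ?_)
          (fun t r hr => dif_neg (by omega))).2 v.2⟩
      left_inv g := Subtype.ext (funext fun t => funext fun r => ?_)
      right_inv v := Subtype.ext (funext fun t => funext fun j => ?_) }
  · have h1 : (⟨N - 1 - (N - 1 - (j : ℕ)), by omega⟩ : Fin N) = j := Fin.ext (by dsimp; omega)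
    rw [dif_pos (by omega), h1, show N - 1 - (N - 1 - (j : ℕ)) = j by omega]
    exact (Nat.add_sub_cancel' (hle v.1 v.2 t j)).symm
  · dsimp only
    have h2 := g.2.1.lo_le t r
    split_ifs with h
    · rw [show N - 1 - (N - 1 - r) = r by omega, Nat.add_sub_cancel_left]
      omega
    · have := e1 g.1 g.2.1 t r (by omega)
      omega
  · have h1 : (⟨N - 1 - (N - 1 - (j : ℕ)), by omega⟩ : Fin N) = j := Fin.ext (by dsimp; omega)
    dsimp only
    rw [dif_pos (by omega), h1, Nat.add_sub_cancel_left,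
      show N - 1 - (N - 1 - (j : ℕ)) = j by omega]
    exact Nat.add_sub_cancel' (hle v.1 v.2 t j)

/-! ### Standard tableaux -/

theorem part_onesPartition (m r : ℕ) : part (onesPartition m) r = if r < m then 1 else 0 := by
  have hl : len (onesPartition m) = m := Multiset.card_replicate m 1
  split_ifs with h
  · have hr : r < (partsList (onesPartition m)).length := by rw [length_partsList, hl]; exact h
    rw [part, List.getD_eq_getElem _ _ hr]
    exact Multiset.eq_of_mem_replicate ((Multiset.mem_sort (· ≥ ·)).1 (List.getElem_mem hr))
  · exact part_eq_zero _ (by omega)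

theorem SkewSSYT.content_apply {A : SkewShape} (T : SkewSSYT A.transpose) (i : ℕ) :
    T.content i = (A.cells.filter fun c => T.entry c.2 c.1 = i).card := by
  classical
  rw [SkewSSYT.content, A.sum_transpose_cells (fun c r => Finsupp.single (T.entry c r) 1),
    Finsupp.finsetSum_apply]
  simp only [Finsupp.single_apply]
  rw [Finset.sum_boole, Nat.cast_id]

/-- Standard tableaux as semistandard tableaux of the transposed shape. -/
def SkewSYT.toSSYT {A : SkewShape} (S : SkewSYT A) : SkewSSYT A.transpose where
  entry c r := open Classical in if h : (r, c) ∈ A.cells then S.filling ⟨(r, c), h⟩ else 0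
  row_weak {c r1 r2} h h1 h2 := by
    rw [A.mem_transpose_cells] at h1 h2
    rw [dif_pos h1, dif_pos h2]
    exact (S.col_strict (c := ⟨(r1, c), h1⟩) (d := ⟨(r2, c), h2⟩) rfl h).le
  col_strict {c1 c2 r} h h1 h2 := by
    rw [A.mem_transpose_cells] at h1 h2
    rw [dif_pos h1, dif_pos h2]
    exact S.row_strict (c := ⟨(r, c1), h1⟩) (d := ⟨(r, c2), h2⟩) rfl h
  zeros h := dif_neg (by rwa [A.mem_transpose_cells] at h)

theorem SkewSYT.toSSYT_entry {A : SkewShape} (S : SkewSYT A) (c : A.cells) :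
    S.toSSYT.entry c.1.2 c.1.1 = S.filling c := dif_pos c.2

theorem SkewSYT.content_toSSYT {A : SkewShape} (S : SkewSYT A) :
    S.toSSYT.content = expo (onesPartition A.cells.card) := by
  ext i
  rw [SkewSSYT.content_apply, expo_apply, part_onesPartition]
  split_ifs with h
  · rw [Finset.card_eq_one]
    refine ⟨S.filling.symm ⟨i, h⟩, Finset.ext fun c => ?_⟩
    rw [Finset.mem_filter, Finset.mem_singleton]
    constructor
    · rintro ⟨h1, h2⟩
      have h3 := S.toSSYT_entry ⟨c, h1⟩
      have h4 : S.filling ⟨c, h1⟩ = ⟨i, h⟩ := Fin.ext (h3.symm.trans h2)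
      rw [← h4, Equiv.symm_apply_apply]
    · rintro rfl
      refine ⟨(S.filling.symm ⟨i, h⟩).2, ?_⟩
      rw [S.toSSYT_entry, Equiv.apply_symm_apply]
  · rw [Finset.card_eq_zero, Finset.filter_eq_empty_iff]
    intro c hc hi
    have h3 := S.toSSYT_entry ⟨c, hc⟩
    have := (S.filling ⟨c, hc⟩).2
    dsimp only at h3
    omega

/-- Content 1^m, with m the number of cells, means that each value below m occurs once. The entries
then form a bijection, and the weak inequalities are automatically strict. -/
theorem numSYT_eq_kostka (A : SkewShape) :
    numSYT A = kostka A.transpose (onesPartition A.cells.card) := by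
  refine Nat.card_eq_of_bijective
    (fun S : SkewSYT A => (⟨S.toSSYT, S.content_toSSYT⟩ : {T : SkewSSYT A.transpose //
      T.content = expo (onesPartition A.cells.card)})) ⟨fun S S' h => ?_, fun T => ?_⟩
  · have h1 : S.toSSYT = S'.toSSYT := congrArg Subtype.val h
    have h2 : S.filling = S'.filling := by
      ext c
      rw [← S.toSSYT_entry, ← S'.toSSYT_entry, h1]
    cases S
    cases S'
    congr
  · obtain ⟨T, hT⟩ := T
    have hcard : ∀ i, (A.cells.filter fun c => T.entry c.2 c.1 = i).card =
        if i < A.cells.card then 1 else 0 := by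
      intro i
      rw [← T.content_apply, hT, expo_apply, part_onesPartition]
    have hlt : ∀ c : A.cells, T.entry c.1.2 c.1.1 < A.cells.card := by
      intro c
      by_contra h
      have h1 := hcard (T.entry c.1.2 c.1.1)
      rw [if_neg h, Finset.card_eq_zero, Finset.filter_eq_empty_iff] at h1
      exact h1 c.2 rfl
    let f : A.cells → Fin A.cells.card := fun c => ⟨T.entry c.1.2 c.1.1, hlt c⟩
    have hinj : Function.Injective f := by
      intro c d h
      have h1 := hcard (T.entry c.1.2 c.1.1)
      rw [if_pos (hlt c)] at h1
      refine Subtype.ext (Finset.card_le_one.1 h1.le _ (Finset.mem_filter.2 ⟨c.2, rfl⟩) _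
        (Finset.mem_filter.2 ⟨d.2, ?_⟩))
      exact (congrArg Fin.val h).symm
    have hbij : Function.Bijective f :=
      (Fintype.bijective_iff_injective_and_card f).2 ⟨hinj, by simp⟩
    refine ⟨⟨Equiv.ofBijective f hbij, fun {c d} h1 h2 => ?_, fun {c d} h1 h2 => ?_⟩, ?_⟩
    · obtain ⟨⟨r, c⟩, hc⟩ := c
      obtain ⟨⟨r', d⟩, hd⟩ := d
      obtain rfl : r = r' := h1
      exact T.col_strict h2 ((A.mem_transpose_cells _ _).2 hc) ((A.mem_transpose_cells _ _).2 hd)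
    · have hne : f c ≠ f d := fun h => by
        rw [hinj h] at h2
        exact lt_irrefl _ h2
      refine lt_of_le_of_ne ?_ hne
      obtain ⟨⟨r, c⟩, hc⟩ := c
      obtain ⟨⟨r', d⟩, hd⟩ := d
      obtain rfl : c = d := h1
      exact T.row_weak h2 ((A.mem_transpose_cells _ _).2 hc) ((A.mem_transpose_cells _ _).2 hd)
    · refine Subtype.ext ?_
      have he : ∀ T' : SkewSSYT A.transpose, T'.entry = T.entry → T' = T := by
        intro T' h
        cases T'
        cases T
        congr
      refine he _ (funext fun c => funext fun r => ?_)
      by_cases h : (r, c) ∈ A.cells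
      · exact dif_pos h
      · rw [T.zeros (by rwa [A.mem_transpose_cells])]
        exact dif_neg h

/-! ### Comparison of coefficients -/

theorem rowDiv_elemPartition_eq_sum_schur {k n : ℕ} (hk : 1 ≤ k) (μ : (k * n).Partition) :
    (rowDiv k (elemPartition μ) : MvPowerSeries ℕ ℚ) =
      ∑ lam : n.Partition, (kostka (stretchedShape k lam).transpose μ : ℚ) • schur lam := by
  ext a
  -- Each coefficient involves finitely many variables; N also bounds n, so that every partition of
  -- n has at most N parts.
  obtain ⟨N, hN, ha⟩ : ∃ N, n ≤ N ∧ ∀ i ∈ a.support, i < N :=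
    ⟨max n (a.support.sup id + 1), le_max_left _ _, fun i hi =>
      lt_max_of_lt_right (Nat.lt_succ_of_le (Finset.le_sup (f := id) hi))⟩
  rw [coeff_rowDiv_elemPartition hk hN μ ha, map_sum]
  refine Finset.sum_congr rfl fun lam _ => ?_
  rw [map_smul, smul_eq_mul, coeff_schur lam hN ha, kostka_eq_walkCount hk lam μ hN]

end SymFun

theorem mainTheorem3 (k n : ℕ) (hk : 1 ≤ k) :
    (∀ μ : (k * n).Partition,
      (SymFun.rowDiv k (SymFun.elemPartition μ) : MvPowerSeries ℕ ℚ) =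
        ∑ lam : n.Partition,
          (SymFun.kostka (SymFun.stretchedShape k lam).transpose μ : ℚ) • SymFun.schur lam) ∧
    (SymFun.rowDiv k (SymFun.elemPartition (SymFun.onesPartition (k * n))) : MvPowerSeries ℕ ℚ) =
      ∑ lam : n.Partition,
        (SymFun.numSYT (SymFun.stretchedShape k lam) : ℚ) • SymFun.schur lam := by
  refine ⟨SymFun.rowDiv_elemPartition_eq_sum_schur hk, ?_⟩
  rw [SymFun.rowDiv_elemPartition_eq_sum_schur hk]
  refine Finset.sum_congr rfl fun lam _ => ?_
  rw [SymFun.numSYT_eq_kostka, SymFun.card_stretchedShape]
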